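/- Let $r\ge 1$, let $0<q_j<1$ $(1\le j\le r)$ with $\sum_{j=1}^r q_j=1$, let $a_1,\dots,a_r>0$ with $a_1,\dots,a_{r-1}$ pairwise distinct, and let $t>0$. For $n\in\mathbb N$ put $\vec n=(n_1,\dots,n_r)$ with $n_j=\lfloor q_j n\rfloor$, and $|\vec n|=n_1+\dots+n_r$. For an integer $N\ge 1$ let $(b_1,\dots,b_r)=(a_1,\dots,a_{r-1},Na_r)$, and let $C_{\vec n}=C_{\vec n,N}$ be the multiple Charlier polynomial with these parameters, that is, the monic polynomial of degree $|\vec n|$ with $$\sum_{k=0}^\infty C_{\vec n}(k)\,k^\ell\,\frac{b_j^k}{k!}=0,\qquad 0\le \ell\le n_j-1,\ 1\le j\le r.$$ If $Na_r\notin\{a_1,\dots,a_{r-1}\}$ (which holds for all large $N$), then there is exactly one such polynomial, and it has $|\vec n|$ distinct zeros $x_{\vec n,1}<\dots<x_{\vec n,|\vec n|}$, all real and positive. Put $\alpha(0)=a_r+t-2\sqrt{a_rq_rt}$ and $\beta_t=a_r+t+2\sqrt{a_rq_rt}$, and let $\alpha_t=\alpha(0)$ if $a_r\ge q_rt$, and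 $\alpha_t=(1-q_r)t$ if $a_r<q_rt$. Define $v$ on $[\alpha_t,\beta_t]$ by $$v(y)=\frac1{q_rt}\quad\text{if } a_r<q_rt \text{ and } y\le\alpha(0),\qquad v(y)=\frac{1}{\pi q_rt}\int_{\frac{y+a_r-t}{2\sqrt{a_r(y-(1-q_r)t)}}}^1\frac{du}{\sqrt{1-u^2}}\quad\text{otherwise}$$ (when $a_r=q_rt$, the value at the single point $y=\alpha_t$ is immaterial; the lower limit of integration is read as $0$ there). Then, for every bounded continuous function $f:[0,\infty)\to\mathbb R$, $$\lim_{n,N\to\infty,\ n/N\to t}\ \frac1{|\vec n|}\sum_{j=1}^{|\vec n|}f\!\left(\frac{x_{\vec n,j}}N\right)=\frac1t\int_0^{(1-q_r)t}f(x)\,dx+q_r\int_{\alpha_t}^{\beta_t}v(x)f(x)\,dx .$$ Moreover $(1-q_r)t\le\alpha_t<\beta_t$, and $(1-q_r)t<\alpha_t$ if and only if $a_r>q_rt$; the function $v$ is a probability density on $[\alpha_t,\beta_t]$ and is strictly positive on $(\alpha_t,\beta_t)$. Thus the support of the limit distribution, $[0,(1-q_r)t]\cup[\alpha_t,\beta_t]$,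 consists of two disjoint intervals if $a_r>q_rt$ and of a single interval if $a_r\le q_rt$. -/

import Mathlib

open Filter Topology MeasureTheory Set

/-- `P` is a type II multiple Charlier polynomial for the multi-index `n` and the Poisson
parameters `a`: it is monic of degree `|n| = ∑ j, n j`, and it is orthogonal to
`1, x, …, x ^ (n j - 1)` with respect to the Poisson weight with parameter `a j`, for every `j`. -/
def IsMultipleCharlier {ι : Type*} [Fintype ι] (n : ι → ℕ) (a : ι → ℝ) (P : Polynomial ℝ) :
    Prop :=
  P.Monic ∧ P.natDegree = ∑ j, n j ∧
    ∀ j, ∀ l < n j,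
      HasSum (fun k : ℕ => P.eval (k : ℝ) * (k : ℝ) ^ l * (a j ^ k / (k.factorial : ℝ))) 0

/-- The multiple Charlier polynomial `C_n` with parameters `a`: the polynomial selected by
`IsMultipleCharlier` (it is unique as soon as the parameters are positive and distinct). -/
noncomputable def multipleCharlier {ι : Type*} [Fintype ι] (n : ι → ℕ) (a : ι → ℝ) :
    Polynomial ℝ :=
  Classical.epsilon (IsMultipleCharlier n a)

/-- The multi-index `(⌊q_1 n⌋, …, ⌊q_r n⌋)`. -/
noncomputable def floorIndex {m : ℕ} (q : Fin (m + 1) → ℝ) (n : ℕ) : Fin (m + 1) → ℕ :=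
  fun j => ⌊q j * (n : ℝ)⌋₊

/-- The parameters `(a_1, …, a_{r-1}, N a_r)`, where `r = m + 1`. -/
def scaledParams {m : ℕ} (a : Fin (m + 1) → ℝ) (N : ℕ) : Fin (m + 1) → ℝ :=
  Function.update a (Fin.last m) ((N : ℝ) * a (Fin.last m))

/-- The normalized sum `(1 / |n|) ∑ f (x_j / N)` over the real zeros `x_j` of `P`, each counted
with its multiplicity, for a polynomial `P` of degree `d = |n|`. -/
noncomputable def zeroAverage (P : Polynomial ℝ) (d N : ℕ) (f : ℝ → ℝ) : ℝ :=
  1 / (d : ℝ) * (P.roots.map (fun x => f (x / (N : ℝ)))).sum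

/-- The left end point `a + t - 2 √(a q t)` of the arc carrying the arcsine-type density. -/
noncomputable def arcLeft (a q t : ℝ) : ℝ := a + t - 2 * √(a * q * t)

/-- The right end point `β_t = a + t + 2 √(a q t)`. -/
noncomputable def betaEnd (a q t : ℝ) : ℝ := a + t + 2 * √(a * q * t)

/-- The left end point `α_t` of the support of `v`. -/
noncomputable def alphaEnd (a q t : ℝ) : ℝ :=
  if q * t ≤ a then arcLeft a q t else (1 - q) * t

/-- The density `v` on `[α_t, β_t]`. -/
noncomputable def zeroDensity (a q t y : ℝ) : ℝ :=
  if a < q * t ∧ y ≤ arcLeft a q t then 1 / (q * t)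
  else
    1 / (Real.pi * q * t) *
      ∫ u in ((y + a - t) / (2 * √(a * (y - (1 - q) * t))))..1, 1 / √(1 - u ^ 2)

/-! Let the umbral map send `X ^ k` to the falling factorial of degree `k`. The factorial moments of
the Poisson weight make the functional with parameter `b` act on umbral images as `exp b` times
evaluation at `b` (`poissonSum_umbral`). Orthogonality thus means vanishing to order `n_j` at `a_j`,
and the multiple Charlier polynomial is the umbral image of `∏ (X - a_j) ^ n_j`.

A factor `X - c` becomes the operator `P ↦ x P(x - 1) - c P(x)`. If the zeros `x_i` of `P` are
positive with gaps at least 1, so are those of the image; they lie at or beyond `0, x_i + 1`, with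
total excess exactly `c` (`SpacedRoots.exists_raising`). Begin with the ordinary Charlier polynomial
with parameter `N a_r` and insert the other `k` factors. The zeros end up beyond `0, …, k - 1` and
`x_j + k`, by `O(k)` in total, so after division by `N` the mean displacement is `O(1/N)` and
disappears in the limit (`tendsto_average_of_dominates`). The first group yields Lebesgue measure on
`[0, (1 - q_r) t]`, the second the Charlier limit law shifted by `(1 - q_r) t`.

For the Charlier law, the scaled zeros are the eigenvalues of a truncated Jacobi matrix that factors
as `(S + a)(D + 1)`, with `S` the shift and `D` the matrix of `h d/dx`, `h = 1/N`. The factors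
commute up to a commutator whose trace pairings stay bounded, so `tr ((LU)^p) = tr (L^p U^p) +
O(1)`, and the right-hand trace is explicit (`abs_trace_jacobi_pow_sub_le`). With `s = q_r t` the
limit moments are `∑ (p choose j)^2 a^(p-j) s^j / (j+1)`. These are the moments of `|w + √a|^2` for
`w` uniform in the disc of radius `√s`, and polar coordinates around the shifted centre give the
arccosine density (`integral_arccos_mul_pow`). A norm bound on the zeros and Weierstrass
approximation pass from moments to continuous functions. -/

/-! ### The umbral map and the raising operator. -/

section Umbral

open Polynomial

/-- The linear map of `ℝ[X]` that sends `X ^ k` to the falling factorial of degree `k`. -/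
noncomputable def umbral : ℝ[X] →ₗ[ℝ] ℝ[X] :=
  Polynomial.lsum fun k => LinearMap.toSpanSingleton ℝ ℝ[X] (descPochhammer ℝ k)

/-- The raising operator `P ↦ x P(x - 1) - c P(x)`. -/
noncomputable def raising (c : ℝ) (P : ℝ[X]) : ℝ[X] := X * P.comp (X - 1) - C c * P

theorem umbral_monomial (k : ℕ) (c : ℝ) : umbral (monomial k c) = c • descPochhammer ℝ k := by
  simp [umbral, Polynomial.lsum_apply, Polynomial.sum_monomial_index]

theorem umbral_X_pow (k : ℕ) : umbral (X ^ k) = descPochhammer ℝ k := by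
  rw [← monomial_one_right_eq_X_pow, umbral_monomial, one_smul]

theorem umbral_one : umbral 1 = 1 := by
  simpa using umbral_X_pow 0

theorem umbral_X_mul (p : ℝ[X]) : umbral (X * p) = X * (umbral p).comp (X - 1) := by
  induction p using Polynomial.induction_on' with
  | add p q hp hq => simp [mul_add, hp, hq]
  | monomial n a =>
    rw [X_mul_monomial, umbral_monomial, umbral_monomial, descPochhammer_succ_left]
    simp

theorem umbral_X_sub_C_mul (c : ℝ) (p : ℝ[X]) :
    umbral ((X - C c) * p) = raising c (umbral p) := by
  rw [sub_mul, map_sub, umbral_X_mul, raising, ← smul_eq_C_mul, map_smul, smul_eq_C_mul]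

/-- Linear extension of `x (x)_k = (x)_(k+1) + k (x)_k`; the source of the three-term recurrence. -/
theorem X_mul_umbral (p : ℝ[X]) :
    X * umbral p = umbral (X * p) + umbral (X * derivative p) := by
  induction p using Polynomial.induction_on' with
  | add p q hp hq => simp only [mul_add, map_add, hp, hq]; ring
  | monomial n a =>
    rw [X_mul_monomial, derivative_monomial, X_mul_monomial, umbral_monomial, umbral_monomial,
      umbral_monomial, descPochhammer_succ_right]
    cases n with
    | zero => simp
    | succ n =>
      simp only [smul_eq_C_mul, Nat.add_sub_cancel, map_mul]
      push_cast
      simp only [map_add, map_natCast, map_one]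
      ring

/-- Falling factorials are monic of every degree, so leading terms can be stripped one at a time. -/
theorem exists_umbral_eq (d : ℕ) (R : ℝ[X]) (hR : R.degree < d) :
    ∃ r : ℝ[X], r.degree < d ∧ umbral r = R := by
  induction d generalizing R with
  | zero =>
    refine ⟨0, by simp, ?_⟩
    have : R = 0 := by
      rw [← degree_eq_bot]
      simpa [Nat.WithBot.lt_zero_iff] using hR
    simp [this]
  | succ d ih =>
    have hdeg : (R - C (R.coeff d) * descPochhammer ℝ d).degree < d := by
      rw [degree_lt_iff_coeff_zero] at hR ⊢
      intro k hk
      rcases hk.eq_or_lt with rfl | hk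
      · have := monic_descPochhammer ℝ d
        rw [Monic, leadingCoeff, descPochhammer_natDegree] at this
        simp [this]
      · rw [coeff_sub, coeff_C_mul, hR k hk, coeff_eq_zero_of_natDegree_lt (p := descPochhammer ℝ d)
          (by rwa [descPochhammer_natDegree])]
        simp
    obtain ⟨r, hr, h⟩ := ih _ hdeg
    refine ⟨r + monomial d (R.coeff d), ?_, ?_⟩
    · refine (degree_add_le _ _).trans_lt (max_lt (hr.trans ?_) ((degree_monomial_le _ _).trans_lt ?_))
      · exact_mod_cast Nat.lt_succ_self d
      · exact_mod_cast Nat.lt_succ_self d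
    · rw [map_add, h, umbral_monomial, smul_eq_C_mul]
      ring

theorem descPochhammer_succ_comp_X_add_one (l : ℕ) :
    (descPochhammer ℝ (l + 1)).comp (X + 1)
      = descPochhammer ℝ (l + 1) + C (l + 1 : ℝ) * descPochhammer ℝ l := by
  have h : (descPochhammer ℝ (l + 1)).comp (X + 1) = (X + 1) * descPochhammer ℝ l := by
    rw [descPochhammer_succ_left, mul_comp, comp_assoc]
    simp
  rw [h, descPochhammer_succ_right]
  simp only [map_add, map_natCast, map_one]
  ring

end Umbral

/-! ### Poisson functionals: orthogonality as divisibility. -/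

section Poisson

open Polynomial

theorem summable_eval_mul_pow_div_factorial (b : ℝ) (P : ℝ[X]) :
    Summable fun k : ℕ => P.eval (k : ℝ) * (b ^ k / (k.factorial : ℝ)) := by
  induction P using Polynomial.induction_on' with
  | add p q hp hq => simpa [add_mul] using hp.add hq
  | monomial l a =>
    refine Summable.of_norm_bounded
      -- Since `k ^ l ≤ l! e ^ k`, the exponential series at `e |b|` dominates.
      (g := fun k : ℕ => (|a| * l.factorial) * ((Real.exp 1 * |b|) ^ k / (k.factorial : ℝ)))
      ((Real.summable_pow_div_factorial _).mul_left _) fun k => ?_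
    have h := Real.pow_div_factorial_le_exp (x := (k : ℝ)) (by positivity) l
    rw [div_le_iff₀ (by positivity)] at h
    have h2 : Real.exp 1 ^ k = Real.exp k := by rw [← Real.exp_nat_mul, mul_one]
    rw [eval_monomial, norm_mul, norm_mul, norm_div, norm_pow, norm_pow, mul_pow, h2]
    simp only [Real.norm_eq_abs, Nat.abs_cast]
    calc |a| * (k : ℝ) ^ l * (|b| ^ k / k.factorial)
        ≤ |a| * (Real.exp k * l.factorial) * (|b| ^ k / k.factorial) := by gcongr
      _ = _ := by ring

/-- The functional `P ↦ ∑ k, P(k) b ^ k / k!`. -/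
noncomputable def poissonSum (b : ℝ) : ℝ[X] →ₗ[ℝ] ℝ where
  toFun P := ∑' k : ℕ, P.eval (k : ℝ) * (b ^ k / (k.factorial : ℝ))
  map_add' P Q := by
    rw [← (summable_eval_mul_pow_div_factorial b P).tsum_add
      (summable_eval_mul_pow_div_factorial b Q)]
    simp [add_mul]
  map_smul' c P := by
    rw [RingHom.id_apply, smul_eq_mul, ← tsum_mul_left]
    simp [mul_assoc]

theorem hasSum_poissonSum (b : ℝ) (P : ℝ[X]) :
    HasSum (fun k : ℕ => P.eval (k : ℝ) * (b ^ k / (k.factorial : ℝ))) (poissonSum b P) :=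
  (summable_eval_mul_pow_div_factorial b P).hasSum

/-- An index shift: the factor `X` kills the term `k = 0`, and `(k + 1) / (k + 1)! = 1 / k!`. -/
theorem poissonSum_shift (b : ℝ) (P : ℝ[X]) :
    poissonSum b (X * P.comp (X - 1)) = b * poissonSum b P := by
  have h := (hasSum_poissonSum b P).mul_left b
  have h2 := hasSum_poissonSum b (X * P.comp (X - 1))
  refine h2.unique ?_
  rw [← hasSum_nat_add_iff' 1]
  simp only [Finset.sum_range_one, eval_mul, eval_X, Nat.cast_zero, zero_mul, sub_zero]
  convert! h using 2 with k
  rw [Nat.factorial_succ]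
  simp only [eval_comp, eval_sub, eval_X, eval_one]
  push_cast
  have : (k.factorial : ℝ) ≠ 0 := by positivity
  have : (k : ℝ) + 1 ≠ 0 := by positivity
  rw [add_sub_cancel_right]
  field_simp
  ring

theorem poissonSum_umbral (b : ℝ) (p : ℝ[X]) :
    poissonSum b (umbral p) = Real.exp b * p.eval b := by
  induction p using Polynomial.induction_on' with
  | add p q hp hq => simp [mul_add, hp, hq]
  | monomial n a =>
    rw [umbral_monomial, map_smul, eval_monomial]
    have : poissonSum b (descPochhammer ℝ n) = Real.exp b * b ^ n := by
      induction n with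
      | zero =>
        refine (hasSum_poissonSum b _).unique ?_
        have := NormedSpace.expSeries_div_hasSum_exp b
        simpa [Real.exp_eq_exp_ℝ] using this
      | succ n ih => rw [descPochhammer_succ_left, poissonSum_shift, ih]; ring
    rw [this, smul_eq_mul]
    ring

/-- Summation by parts: the adjoint of raising acts on test functions as `g ↦ b g(x + 1) - c g(x)`.
-/
theorem poissonSum_raising_mul (b c : ℝ) (P g : ℝ[X]) :
    poissonSum b (raising c P * g)
      = b * poissonSum b (P * g.comp (X + 1)) - c * poissonSum b (P * g) := by
  have h : raising c P * g = X * (P * g.comp (X + 1)).comp (X - 1) - c • (P * g) := by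
    rw [raising, mul_comp, comp_assoc, smul_eq_C_mul]
    simp
    ring
  rw [h, map_sub, poissonSum_shift, map_smul, smul_eq_mul]

/-- `R` is orthogonal to all polynomials of degree `< n` with respect to the Poisson weight. -/
def PoissonOrthogonal (b : ℝ) (n : ℕ) (R : ℝ[X]) : Prop :=
  ∀ l < n, poissonSum b (R * descPochhammer ℝ l) = 0

theorem PoissonOrthogonal.mul_eq_zero {b : ℝ} {n : ℕ} {R : ℝ[X]} (h : PoissonOrthogonal b n R)
    {g : ℝ[X]} (hg : g.degree < n) : poissonSum b (R * g) = 0 := by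
  obtain ⟨r, hr, rfl⟩ := exists_umbral_eq n g hg
  by_cases hr0 : r = 0
  · simp [hr0]
  rw [as_sum_range' r n ?_]
  · rw [map_sum, Finset.mul_sum, map_sum]
    refine Finset.sum_eq_zero fun l hl => ?_
    rw [umbral_monomial, mul_smul_comm, map_smul, h l (Finset.mem_range.1 hl), smul_zero]
  · rwa [natDegree_lt_iff_degree_lt hr0]

theorem poissonOrthogonal_iff_X_pow {b : ℝ} {n : ℕ} {R : ℝ[X]} :
    PoissonOrthogonal b n R ↔ ∀ l < n, poissonSum b (R * X ^ l) = 0 := by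
  refine ⟨fun h l hl => h.mul_eq_zero ?_, fun h l hl => ?_⟩
  · rw [degree_X_pow]; exact_mod_cast hl
  · rw [as_sum_range' (descPochhammer ℝ l) n (by rwa [descPochhammer_natDegree]), Finset.mul_sum,
      map_sum]
    refine Finset.sum_eq_zero fun i hi => ?_
    rw [← C_mul_X_pow_eq_monomial, ← smul_eq_C_mul, mul_smul_comm, map_smul,
      h i (Finset.mem_range.1 hi), smul_zero]

theorem poissonSum_raising_self_succ (b : ℝ) (P : ℝ[X]) (l : ℕ) :
    poissonSum b (raising b P * descPochhammer ℝ (l + 1))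
      = b * (l + 1) * poissonSum b (P * descPochhammer ℝ l) := by
  rw [poissonSum_raising_mul, descPochhammer_succ_comp_X_add_one, mul_add, map_add,
    ← smul_eq_C_mul, mul_smul_comm, map_smul, smul_eq_mul]
  ring

theorem PoissonOrthogonal.raising {b : ℝ} {n : ℕ} {P : ℝ[X]} (h : PoissonOrthogonal b n P)
    (c : ℝ) : PoissonOrthogonal b n (raising c P) := by
  intro l hl
  rw [poissonSum_raising_mul, h l hl]
  cases l with
  | zero => simpa using Or.inr (by simpa using h 0 hl)
  | succ l =>
    rw [descPochhammer_succ_comp_X_add_one, mul_add, map_add, ← smul_eq_C_mul, mul_smul_comm,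
      map_smul, h _ hl, h l (by omega)]
    simp

/-- For `c = b` the adjoint is `b` times the forward difference, which lowers the degree and kills
constants; hence one more order of orthogonality. For other `c` the degree of the test function does
not grow, so the order is kept. -/
theorem PoissonOrthogonal.raising_self {b : ℝ} {n : ℕ} {P : ℝ[X]}
    (h : PoissonOrthogonal b n P) : PoissonOrthogonal b (n + 1) (_root_.raising b P) := by
  intro l hl
  cases l with
  | zero => simpa using poissonSum_raising_mul b b P 1
  | succ l => rw [poissonSum_raising_self_succ, h l (by omega), mul_zero]

/-- Testing against `1` gives the root `b`. Once it is divided out, the test of degree `l + 1` for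
`r` is a nonzero multiple of the test of degree `l` for the quotient. -/
theorem pow_dvd_of_poissonOrthogonal {b : ℝ} (hb : b ≠ 0) {n : ℕ} {r : ℝ[X]}
    (h : PoissonOrthogonal b n (umbral r)) : (X - C b) ^ n ∣ r := by
  induction n generalizing r with
  | zero => simp
  | succ n ih =>
    have h0 : r.IsRoot b := by
      have := h 0 (by omega)
      rw [descPochhammer_zero, mul_one, poissonSum_umbral] at this
      exact (mul_eq_zero.1 this).resolve_left (Real.exp_pos b).ne'
    obtain ⟨r', rfl⟩ := dvd_iff_isRoot.2 h0
    rw [pow_succ']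
    refine mul_dvd_mul_left _ (ih fun l hl => ?_)
    have := h (l + 1) (by omega)
    rw [umbral_X_sub_C_mul, poissonSum_raising_self_succ] at this
    exact (mul_eq_zero.1 this).resolve_left (mul_ne_zero hb (by positivity))

theorem poissonOrthogonal_umbral_mul {b : ℝ} (n : ℕ) (p : ℝ[X]) (s : Multiset ℝ) :
    PoissonOrthogonal b n
      (umbral ((s.map fun c => X - C c).prod * (X - C b) ^ n * p)) := by
  induction s using Multiset.induction_on with
  | empty =>
    induction n with
    | zero => intro l hl; omega
    | succ n ih =>
      have : (X - C b) ^ (n + 1) * p = (X - C b) * ((X - C b) ^ n * p) := by ring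
      simp only [Multiset.map_zero, Multiset.prod_zero, one_mul] at ih ⊢
      rw [this, umbral_X_sub_C_mul]
      exact ih.raising_self
  | cons c s ih =>
    rw [Multiset.map_cons, Multiset.prod_cons, mul_assoc, mul_assoc, umbral_X_sub_C_mul,
      ← mul_assoc]
    exact ih.raising c

end Poisson

/-! ### Zeros under the raising operator. -/

section Interlacing

open Polynomial

/-- `P` is monic of degree `d` with roots `x 0, …, x (d - 1)`, which are positive and separated
by gaps of length at least `1`. -/
structure SpacedRoots (P : ℝ[X]) (d : ℕ) (x : ℕ → ℝ) : Prop where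
  eq_prod : P = ∏ i ∈ Finset.range d, (X - C (x i))
  pos : ∀ i < d, 0 < x i
  spaced : ∀ i, i + 1 < d → x i + 1 ≤ x (i + 1)

namespace SpacedRoots

variable {P : ℝ[X]} {d : ℕ} {x : ℕ → ℝ}

theorem lt_add_one_le (h : SpacedRoots P d x) {i j : ℕ} (hij : i < j) (hj : j < d) :
    x i + 1 ≤ x j := by
  induction j, hij using Nat.le_induction with
  | base => exact h.spaced i hj
  | succ k hk ih =>
    have := h.spaced k hj
    have := ih (by omega)
    linarith

theorem mono (h : SpacedRoots P d x) {i j : ℕ} (hij : i ≤ j) (hj : j < d) : x i ≤ x j := by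
  rcases hij.eq_or_lt with rfl | hij
  · rfl
  · linarith [h.lt_add_one_le hij hj]

theorem monic (h : SpacedRoots P d x) : P.Monic := by
  rw [h.eq_prod]
  exact monic_prod_of_monic _ _ fun i _ => monic_X_sub_C _

theorem natDegree (h : SpacedRoots P d x) : P.natDegree = d := by
  rw [h.eq_prod, natDegree_prod_of_monic _ _ fun i _ => monic_X_sub_C _]
  simp

theorem roots (h : SpacedRoots P d x) : P.roots = (Multiset.range d).map x := by
  rw [h.eq_prod, Finset.prod_eq_multiset_prod, Finset.range_val,
    show (Multiset.range d).map (fun i => X - C (x i))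
      = ((Multiset.range d).map x).map fun a => X - C a by rw [Multiset.map_map]; rfl,
    roots_multiset_prod_X_sub_C]

theorem nodup_roots (h : SpacedRoots P d x) : P.roots.Nodup := by
  rw [h.roots]
  refine Multiset.Nodup.map_on (fun i hi j hj hij => ?_) (Multiset.nodup_range d)
  rw [Multiset.mem_range] at hi hj
  rcases lt_trichotomy i j with hlt | heq | hlt
  · linarith [h.lt_add_one_le hlt hj]
  · exact heq
  · linarith [h.lt_add_one_le hlt hi]

theorem eval_eq (h : SpacedRoots P d x) (u : ℝ) :
    P.eval u = ∏ i ∈ Finset.range d, (u - x i) := by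
  rw [h.eq_prod, eval_prod]
  simp

theorem eval_root (h : SpacedRoots P d x) {i : ℕ} (hi : i < d) : P.eval (x i) = 0 := by
  rw [h.eval_eq]
  exact Finset.prod_eq_zero (Finset.mem_range.2 hi) (sub_self _)

theorem sign_eval (h : SpacedRoots P d x) {i : ℕ} (hi : i ≤ d) {u : ℝ}
    (h1 : ∀ j < i, x j ≤ u) (h2 : ∀ j, i ≤ j → j < d → u ≤ x j) :
    0 ≤ (-1) ^ (d - i) * P.eval u := by
  rw [h.eval_eq, ← Finset.prod_range_mul_prod_Ico _ hi, mul_left_comm]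
  refine mul_nonneg (Finset.prod_nonneg fun j hj => ?_) ?_
  · linarith [h1 j (Finset.mem_range.1 hj)]
  · rw [← Nat.card_Ico i d, ← Finset.prod_const, ← Finset.prod_mul_distrib]
    refine Finset.prod_nonneg fun j hj => ?_
    rw [Finset.mem_Ico] at hj
    linarith [h2 j hj.1 hj.2]

theorem X_mul_comp_eq_prod (h : SpacedRoots P d x) :
    X * P.comp (X - 1) = ∏ i ∈ Finset.range (d + 1),
      (X - C (if i = 0 then 0 else x (i - 1) + 1)) := by
  rw [Finset.prod_range_succ', h.eq_prod, Polynomial.prod_comp, mul_comm]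
  simp only [sub_comp, X_comp, C_comp]
  congr 1
  · refine Finset.prod_congr rfl fun i _ => ?_
    simp
    ring
  · simp

theorem coeff_of_eq_prod {y : ℕ → ℝ} {Q : ℝ[X]}
    (h : Q = ∏ i ∈ Finset.range (d + 1), (X - C (y i))) :
    Q.coeff d = -∑ i ∈ Finset.range (d + 1), y i := by
  have := prod_X_sub_C_coeff_card_pred (Finset.range (d + 1)) y (by simp)
  rw [Finset.card_range, Nat.add_sub_cancel] at this
  rw [h, this]

/-- The zeros of `x P(x - 1) - c P(x)` dominate those of `x P(x - 1)`. -/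
theorem exists_raising (h : SpacedRoots P d x) {c : ℝ} (hc : 0 < c) :
    ∃ y : ℕ → ℝ, SpacedRoots (raising c P) (d + 1) y ∧ (∀ i < d, x i + 1 ≤ y (i + 1)) ∧
      ∑ i ∈ Finset.range (d + 1), y i = ∑ i ∈ Finset.range d, (x i + 1) + c := by
  set Q := raising c P with hQ
  -- The zeros `0, x 0 + 1, …, x (d - 1) + 1` of `x P(x - 1)`.
  set lo : ℕ → ℝ := fun i => if i = 0 then 0 else x (i - 1) + 1 with hlo
  have hlo0 : lo 0 = 0 := by simp [hlo]
  have hlos : ∀ i, lo (i + 1) = x i + 1 := by simp [hlo]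
  have hQeval : ∀ u, Q.eval u = u * P.eval (u - 1) - c * P.eval u := by
    intro u
    simp [hQ, raising]
  have hlo_nonneg : ∀ i ≤ d, 0 ≤ lo i := by
    rintro (_ | i) hi
    · rw [hlo0]
    · rw [hlos]; linarith [h.pos i hi]
  have hlo_left : ∀ i ≤ d, ∀ j < i, x j + 1 ≤ lo i := by
    rintro (_ | i) hi j hj
    · omega
    · rw [hlos]; linarith [h.mono (Nat.lt_succ_iff.1 hj) hi]
  have hlo_right : ∀ i j, i ≤ j → j < d → lo i ≤ x j := by
    rintro (_ | i) j hij hj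
    · rw [hlo0]; exact (h.pos j hj).le
    · rw [hlos]; exact h.lt_add_one_le hij hj
  have hQlo : ∀ i ≤ d, Q.eval (lo i) = -c * P.eval (lo i) := by
    rintro (_ | i) hi
    · rw [hQeval, hlo0]; ring
    · rw [hQeval, hlos, add_sub_cancel_right, h.eval_root hi]; ring
  -- The lower bound `lo 0 = 0` only gives nonnegative zeros; this makes them positive.
  have hQ0 : Q.eval 0 ≠ 0 := by
    have := hQlo 0 (Nat.zero_le d)
    rw [hlo0] at this
    rw [this]
    refine mul_ne_zero (neg_ne_zero.2 hc.ne') ?_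
    rw [h.eval_eq]
    refine Finset.prod_ne_zero_iff.2 fun i hi => ?_
    have := h.pos i (Finset.mem_range.1 hi)
    linarith
  -- At `lo i` only `-c P(lo i)` survives, at `x i` only `x i * P(x i - 1)`. Because of the gaps,
  -- both evaluation points of `P` have the same `d - i` zeros at or above them, so the two values
  -- of `Q` have opposite weak signs.
  have key : ∀ i, ∃ u, i < d → lo i ≤ u ∧ u ≤ x i ∧ Q.eval u = 0 := by
    intro i
    by_cases hi : i < d
    swap
    · exact ⟨0, fun h => absurd h hi⟩
    have hle := hlo_right i i le_rfl hi
    have hcont : ContinuousOn (fun u => (-1) ^ (d - i) * Q.eval u) (Icc (lo i) (x i)) := by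
      fun_prop
    have h1 : (-1) ^ (d - i) * Q.eval (lo i) ≤ 0 := by
      have := h.sign_eval hi.le (fun j hj => by linarith [hlo_left i hi.le j hj])
        (fun j hij hj => hlo_right i j hij hj)
      rw [hQlo i hi.le]
      nlinarith
    have h2 : 0 ≤ (-1) ^ (d - i) * Q.eval (x i) := by
      have := h.sign_eval (u := x i - 1) hi.le
        (fun j hj => by linarith [h.lt_add_one_le hj hi])
        (fun j hij hj => by linarith [h.mono hij hj])
      rw [hQeval, h.eval_root hi, mul_zero, sub_zero, mul_left_comm]
      exact mul_nonneg (h.pos i hi).le this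
    obtain ⟨u, hu, hu0⟩ := intermediate_value_Icc hle hcont ⟨h1, h2⟩
    refine ⟨u, fun _ => ⟨hu.1, hu.2, ?_⟩⟩
    simpa using hu0
  choose y hy using key
  have hylt : ∀ i j, i < j → j < d → y i < y j := by
    intro i j hij hj
    linarith [(hy i (hij.trans hj)).2.1, (hy j hj).1, hlo_left j hj.le i hij]
  have hlodeg : (X * P.comp (X - 1)).Monic ∧ (X * P.comp (X - 1)).natDegree = d + 1 := by
    rw [h.X_mul_comp_eq_prod]
    refine ⟨monic_prod_of_monic _ _ fun i _ => monic_X_sub_C _, ?_⟩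
    rw [natDegree_prod_of_monic _ _ fun i _ => monic_X_sub_C _]
    simp
  have hdeglt : (C c * P).degree < (X * P.comp (X - 1)).degree := by
    rw [degree_C_mul hc.ne', degree_eq_natDegree h.monic.ne_zero,
      degree_eq_natDegree hlodeg.1.ne_zero, hlodeg.2, h.natDegree]
    exact_mod_cast Nat.lt_succ_self d
  have hQmonic : Q.Monic := hlodeg.1.sub_of_left hdeglt
  have hQdeg : Q.natDegree = d + 1 := by
    rw [hQ, raising, natDegree_sub_eq_left_of_natDegree_lt (natDegree_lt_natDegree ?_ hdeglt),
      hlodeg.2]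
    exact mul_ne_zero (C_ne_zero.2 hc.ne') h.monic.ne_zero
  set A : ℝ[X] := ∏ i ∈ Finset.range d, (X - C (y i)) with hA
  have hAmonic : A.Monic := monic_prod_of_monic _ _ fun i _ => monic_X_sub_C _
  have hAdeg : A.natDegree = d := by
    rw [hA, natDegree_prod_of_monic _ _ fun i _ => monic_X_sub_C _]
    simp
  have hdvd : A ∣ Q := by
    refine Finset.prod_dvd_of_coprime (fun i hi j hj hij => ?_) fun i hi => ?_
    · rw [Finset.coe_range, mem_Iio] at hi hj
      refine isCoprime_X_sub_C_of_isUnit_sub (IsUnit.mk0 _ (sub_ne_zero.2 ?_))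
      rcases lt_or_gt_of_ne hij with hlt | hlt
      · exact (hylt _ _ hlt hj).ne
      · exact (hylt _ _ hlt hi).ne'
    · exact dvd_iff_isRoot.2 (hy i (Finset.mem_range.1 hi)).2.2
  -- The `d` zeros found so far leave a monic linear cofactor, whose root `w` is the largest zero.
  obtain ⟨B, hB⟩ := hdvd
  have hBmonic : B.Monic := hAmonic.of_mul_monic_left (hB ▸ hQmonic)
  have hBdeg : B.natDegree = 1 := by
    have := hAmonic.natDegree_mul hBmonic
    rw [← hB, hQdeg, hAdeg] at this
    omega
  obtain ⟨w, hw⟩ : ∃ w, B = X - C w :=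
    ⟨-B.coeff 0, by simpa using hBmonic.eq_X_add_C hBdeg⟩
  have hlow : lo d ≤ w := by
    have h1 : Q.eval (lo d) ≤ 0 := by
      have := h.sign_eval (u := lo d) le_rfl (fun j hj => by linarith [hlo_left d le_rfl j hj])
        (fun j hij hj => by omega)
      rw [Nat.sub_self, pow_zero, one_mul] at this
      rw [hQlo d le_rfl]
      nlinarith
    have h2 : 0 < A.eval (lo d) := by
      rw [hA, eval_prod]
      refine Finset.prod_pos fun i hi => ?_
      have hi := Finset.mem_range.1 hi
      simp only [eval_sub, eval_X, eval_C]
      linarith [(hy i hi).2.1, hlo_left d le_rfl i hi]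
    rw [hB, hw, eval_mul, eval_sub, eval_X, eval_C] at h1
    by_contra! hlt
    have := mul_pos h2 (sub_pos.2 hlt)
    linarith
  set z : ℕ → ℝ := fun i => if i < d then y i else w with hz
  have hzlt : ∀ i < d, z i = y i := fun i hi => by simp [hz, hi]
  have hzd : z d = w := by simp [hz]
  have hlez : ∀ i ≤ d, lo i ≤ z i := by
    intro i hi
    rcases hi.lt_or_eq with hi | rfl
    · rw [hzlt i hi]; exact (hy i hi).1
    · rw [hzd]; exact hlow
  have hQz : Q = ∏ i ∈ Finset.range (d + 1), (X - C (z i)) := by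
    rw [Finset.prod_range_succ, hzd, hB, hw, hA]
    congr 1
    exact Finset.prod_congr rfl fun i hi => by rw [hzlt i (Finset.mem_range.1 hi)]
  have hQroot : ∀ i ≤ d, Q.eval (z i) = 0 := by
    intro i hi
    rw [hQz, eval_prod]
    exact Finset.prod_eq_zero (i := i) (Finset.mem_range.2 (by omega)) (by simp)
  refine ⟨z, ⟨hQz, ?_, ?_⟩, ?_, ?_⟩
  · intro i hi
    refine lt_of_le_of_ne ((hlo_nonneg i (by omega)).trans (hlez i (by omega))) fun h0 => hQ0 ?_
    have := hQroot i (by omega)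
    rwa [← h0] at this
  -- The old zero separates the new ones: `z i ≤ x i` and `x i + 1 ≤ z (i + 1)`.
  · intro i hi
    have := hlez (i + 1) (by omega)
    rw [hlos] at this
    rw [hzlt i (by omega)]
    linarith [(hy i (by omega)).2.1]
  · intro i hi
    rw [← hlos]
    exact hlez _ hi
  -- Compare subleading coefficients: as `P` is monic of degree `d`, subtracting `c P` lowers the
  -- coefficient of `X ^ d` by `c`.
  · have h1 := coeff_of_eq_prod hQz
    have h2 := coeff_of_eq_prod h.X_mul_comp_eq_prod
    have h3 : P.coeff d = 1 := by
      have := h.monic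
      rwa [Monic, leadingCoeff, h.natDegree] at this
    have h4 : Q.coeff d = (X * P.comp (X - 1)).coeff d - c := by
      rw [hQ, raising, coeff_sub, coeff_C_mul, h3, mul_one]
    have h5 : ∑ i ∈ Finset.range (d + 1), lo i = ∑ i ∈ Finset.range d, (x i + 1) := by
      rw [Finset.sum_range_succ', hlo0, add_zero]
      exact Finset.sum_congr rfl fun i _ => hlos i
    linarith

/-- Multiplying the umbral symbol by `∏ (X - c)` moves the zeros beyond the zeros
`0, 1, …, k - 1, x 0 + k, …, x (d - 1) + k` of the product by `X ^ k`, by `∑ c` in total. -/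
theorem exists_umbral_mul {p : ℝ[X]} (h : SpacedRoots (umbral p) d x) (s : Multiset ℝ)
    (hs : ∀ c ∈ s, 0 < c) :
    ∃ y : ℕ → ℝ, SpacedRoots (umbral ((s.map fun c => X - C c).prod * p)) (s.card + d) y ∧
      (∀ i < s.card, (i : ℝ) ≤ y i) ∧ (∀ i < d, x i + s.card ≤ y (s.card + i)) ∧
      ∑ i ∈ Finset.range (s.card + d), y i
        = ∑ i ∈ Finset.range s.card, (i : ℝ) + ∑ i ∈ Finset.range d, (x i + s.card) + s.sum := by
  induction s using Multiset.induction_on with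
  | empty => exact ⟨x, by simpa using h, by simp, by simp, by simp⟩
  | cons c s ih =>
    obtain ⟨y, hy, h1, h2, h3⟩ := ih fun b hb => hs b (Multiset.mem_cons_of_mem hb)
    obtain ⟨z, hz, h4, h5⟩ := hy.exists_raising (hs c (Multiset.mem_cons_self c s))
    have hcard : (c ::ₘ s).card + d = s.card + d + 1 := by rw [Multiset.card_cons]; omega
    refine ⟨z, ?_, ?_, ?_, ?_⟩
    · rw [Multiset.map_cons, Multiset.prod_cons, mul_assoc, umbral_X_sub_C_mul, hcard]
      exact hz
    · rintro (_ | i) hi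
      · simpa using (hz.pos 0 (by omega)).le
      · rw [Multiset.card_cons] at hi
        push_cast
        linarith [h1 i (by omega), h4 i (by omega)]
    · intro i hi
      have := h4 (s.card + i) (by omega)
      rw [Multiset.card_cons, show s.card + 1 + i = s.card + i + 1 by ring]
      push_cast
      linarith [h2 i hi]
    -- A unit shift of `0, …, k - 1` together with the fresh zero `0` gives `0, …, k`.
    · have e : ∀ k : ℕ, ∑ i ∈ Finset.range k, (i : ℝ) + k = ∑ i ∈ Finset.range (k + 1), (i : ℝ) :=
        fun k => (Finset.sum_range_succ _ k).symm
      rw [hcard, h5, Finset.sum_add_distrib, h3, Multiset.card_cons, Multiset.sum_cons, ← e,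
        Finset.sum_add_distrib, Finset.sum_add_distrib]
      simp only [Finset.sum_const, Finset.card_range, nsmul_eq_mul]
      push_cast
      ring

end SpacedRoots

theorem spacedRoots_one (x : ℕ → ℝ) : SpacedRoots (1 : ℝ[X]) 0 x :=
  ⟨by simp, by simp, by simp⟩

theorem exists_spacedRoots_umbral (s : Multiset ℝ) (hs : ∀ c ∈ s, 0 < c) :
    ∃ y : ℕ → ℝ, SpacedRoots (umbral (s.map fun c => X - C c).prod) s.card y := by
  obtain ⟨y, hy, -⟩ := SpacedRoots.exists_umbral_mul (p := 1) (d := 0) (x := 0)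
    (by rw [umbral_one]; exact spacedRoots_one 0) s hs
  exact ⟨y, by simpa using hy⟩

end Interlacing

/-! ### Existence, uniqueness and closed form of the multiple Charlier polynomial. -/

section MultipleCharlier

open Polynomial

variable {ι : Type*}

/-- The multiset in which every `a j` occurs `n j` times. -/
def paramMultiset (n : ι → ℕ) (a : ι → ℝ) (s : Finset ι) : Multiset ℝ :=
  ∑ j ∈ s, Multiset.replicate (n j) (a j)

theorem prod_paramMultiset (n : ι → ℕ) (a : ι → ℝ) (s : Finset ι) :
    ((paramMultiset n a s).map fun c => X - C c).prod = ∏ j ∈ s, (X - C (a j)) ^ n j := by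
  classical
  induction s using Finset.induction_on with
  | empty => simp [paramMultiset]
  | insert j s hj ih =>
    rw [Finset.prod_insert hj, ← ih]
    simp [paramMultiset, Finset.sum_insert hj]

theorem card_paramMultiset (n : ι → ℕ) (a : ι → ℝ) (s : Finset ι) :
    (paramMultiset n a s).card = ∑ j ∈ s, n j := by
  simp [paramMultiset, Multiset.card_sum]

theorem sum_paramMultiset (n : ι → ℕ) (a : ι → ℝ) (s : Finset ι) :
    (paramMultiset n a s).sum = ∑ j ∈ s, n j * a j := by
  classical
  induction s using Finset.induction_on with
  | empty => simp [paramMultiset]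
  | insert j s hj ih =>
    rw [Finset.sum_insert hj, ← ih]
    simp [paramMultiset, Finset.sum_insert hj]

theorem pos_of_mem_paramMultiset {n : ι → ℕ} {a : ι → ℝ} (ha : ∀ j, 0 < a j) {s : Finset ι}
    {c : ℝ} (hc : c ∈ paramMultiset n a s) : 0 < c := by
  rw [paramMultiset, Multiset.mem_sum] at hc
  obtain ⟨j, -, hj⟩ := hc
  rw [Multiset.eq_of_mem_replicate hj]
  exact ha j

variable [Fintype ι]

/-- The multiple Charlier polynomial in closed form. -/
noncomputable def charlierProd (n : ι → ℕ) (a : ι → ℝ) : ℝ[X] :=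
  umbral (∏ j, (X - C (a j)) ^ n j)

theorem exists_spacedRoots_charlierProd (n : ι → ℕ) {a : ι → ℝ} (ha : ∀ j, 0 < a j) :
    ∃ y : ℕ → ℝ, SpacedRoots (charlierProd n a) (∑ j, n j) y := by
  obtain ⟨y, hy⟩ := exists_spacedRoots_umbral (paramMultiset n a Finset.univ)
    fun c hc => pos_of_mem_paramMultiset ha hc
  rw [prod_paramMultiset, card_paramMultiset] at hy
  exact ⟨y, hy⟩

theorem poissonOrthogonal_charlierProd (n : ι → ℕ) (a : ι → ℝ) (j : ι) :
    PoissonOrthogonal (a j) (n j) (charlierProd n a) := by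
  classical
  have := poissonOrthogonal_umbral_mul (b := a j) (n j) 1
    (paramMultiset n a (Finset.univ.erase j))
  rw [prod_paramMultiset, mul_one, Finset.prod_erase_mul _ _ (Finset.mem_univ j)] at this
  exact this

theorem isMultipleCharlier_iff_orthogonal {n : ι → ℕ} {a : ι → ℝ} {P : ℝ[X]} :
    IsMultipleCharlier n a P ↔ P.Monic ∧ P.natDegree = ∑ j, n j ∧
      ∀ j, PoissonOrthogonal (a j) (n j) P := by
  have h : ∀ b l, HasSum (fun k : ℕ => P.eval (k : ℝ) * (k : ℝ) ^ l * (b ^ k / (k.factorial : ℝ))) 0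
      ↔ poissonSum b (P * X ^ l) = 0 := by
    intro b l
    have := hasSum_poissonSum b (P * X ^ l)
    simp only [eval_mul, eval_pow, eval_X] at this
    exact ⟨fun h => this.unique h, fun h => h ▸ this⟩
  simp only [IsMultipleCharlier, poissonOrthogonal_iff_X_pow, h]

theorem isMultipleCharlier_charlierProd (n : ι → ℕ) {a : ι → ℝ} (ha : ∀ j, 0 < a j) :
    IsMultipleCharlier n a (charlierProd n a) := by
  obtain ⟨y, hy⟩ := exists_spacedRoots_charlierProd n ha
  exact isMultipleCharlier_iff_orthogonal.2
    ⟨hy.monic, hy.natDegree, poissonOrthogonal_charlierProd n a⟩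

/-- The difference of two solutions is the umbral image of some `r` of degree below `|n|`.
Orthogonality makes `r` divisible by the powers `(X - a j) ^ n j`, which are pairwise coprime with
total degree `|n|`, so `r = 0`. -/
theorem IsMultipleCharlier.eq_charlierProd {n : ι → ℕ} {a : ι → ℝ} (ha : ∀ j, 0 < a j)
    (hinj : Function.Injective a) {P : ℝ[X]} (hP : IsMultipleCharlier n a P) :
    P = charlierProd n a := by
  have h1 := isMultipleCharlier_iff_orthogonal.1 hP
  have h2 := isMultipleCharlier_iff_orthogonal.1 (isMultipleCharlier_charlierProd n ha)
  set Q := charlierProd n a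
  have hdeg : (P - Q).degree < (∑ j, n j : ℕ) := by
    have := degree_sub_lt_left (p := P) (q := Q) ?_ h1.1.ne_zero (by rw [h1.1, h2.1])
    · rwa [degree_eq_natDegree h1.1.ne_zero, h1.2.1] at this
    · rw [degree_eq_natDegree h1.1.ne_zero, degree_eq_natDegree h2.1.ne_zero, h1.2.1, h2.2.1]
  obtain ⟨r, hr, hrPQ⟩ := exists_umbral_eq _ _ hdeg
  have hdvd : ∏ j, (X - C (a j)) ^ n j ∣ r := by
    refine Finset.prod_dvd_of_coprime (fun i _ j _ hij => ?_) fun j _ => ?_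
    · exact (isCoprime_X_sub_C_of_isUnit_sub
        (IsUnit.mk0 _ (sub_ne_zero.2 (hinj.ne hij)))).pow
    · refine pow_dvd_of_poissonOrthogonal (ha j).ne' fun l hl => ?_
      rw [hrPQ, sub_mul, map_sub, h1.2.2 j l hl, h2.2.2 j l hl, sub_zero]
  have hr0 : r = 0 := by
    refine eq_zero_of_dvd_of_degree_lt hdvd (hr.trans_le (le_of_eq ?_))
    have hm : ∀ j ∈ Finset.univ, ((X - C (a j)) ^ n j).Monic := fun j _ => (monic_X_sub_C _).pow _
    rw [degree_eq_natDegree (monic_prod_of_monic _ _ hm).ne_zero, natDegree_prod_of_monic _ _ hm]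
    simp
  rw [hr0, map_zero] at hrPQ
  exact sub_eq_zero.1 hrPQ.symm

theorem multipleCharlier_eq (n : ι → ℕ) {a : ι → ℝ} (ha : ∀ j, 0 < a j)
    (hinj : Function.Injective a) : multipleCharlier n a = charlierProd n a :=
  (Classical.epsilon_spec (p := IsMultipleCharlier n a)
    ⟨_, isMultipleCharlier_charlierProd n ha⟩).eq_charlierProd ha hinj

end MultipleCharlier

/-! ### Reordering products under a trace. -/

section TraceCommutator

variable {R : Type*} [NormedRing R] [NormOneClass R] {τ : R →+ ℝ} {L U : R} {ε κ : ℝ}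

theorem norm_pow_le_of_norm_le {x : R} (hx : ‖x‖ ≤ κ) (p : ℕ) : ‖x ^ p‖ ≤ κ ^ p :=
  (norm_pow_le x p).trans (pow_le_pow_left₀ (norm_nonneg x) hx p)

/-- The commutator of `U ^ p` with `L` telescopes into `p` terms with one basic commutator each;
cyclicity moves the trailing powers of `U` into `W`. -/
theorem abs_trace_mul_pow_commutator_le (hτ : ∀ x y, τ (x * y) = τ (y * x)) (hε : 0 ≤ ε)
    (hκ : 1 ≤ κ) (hU : ‖U‖ ≤ κ) (hc : ∀ W, |τ (W * (U * L - L * U))| ≤ ε * ‖W‖) (p : ℕ) (W : R) :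
    |τ (W * (U ^ p * L - L * U ^ p))| ≤ p * ε * κ ^ p * ‖W‖ := by
  induction p generalizing W with
  | zero => simp
  | succ p ih =>
    have e : W * (U ^ (p + 1) * L - L * U ^ (p + 1))
        = W * U ^ p * (U * L - L * U) + W * (U ^ p * L - L * U ^ p) * U := by
      rw [pow_succ]; noncomm_ring
    have h1 : |τ (W * U ^ p * (U * L - L * U))| ≤ ε * κ ^ p * ‖W‖ := by
      refine (hc _).trans ?_
      rw [mul_assoc, mul_comm (κ ^ p)]
      gcongr
      exact (norm_mul_le _ _).trans (by gcongr; exact norm_pow_le_of_norm_le hU p)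
    have h2 : |τ (W * (U ^ p * L - L * U ^ p) * U)| ≤ p * ε * κ ^ p * (κ * ‖W‖) := by
      rw [hτ, ← mul_assoc]
      refine (ih _).trans ?_
      gcongr
      exact (norm_mul_le _ _).trans (by gcongr)
    rw [e, map_add]
    refine (abs_add_le _ _).trans ((add_le_add h1 h2).trans ?_)
    have h3 : ε * κ ^ p * ‖W‖ ≤ ε * κ ^ (p + 1) * ‖W‖ := by
      gcongr
      omega
    push_cast
    rw [pow_succ] at h3 ⊢
    linarith

/-- Each new `L` is moved past the accumulated power of `U`. Assuming `hc` only for trace pairings,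
instead of a norm bound on the commutator, is what admits a single large corner entry. -/
theorem abs_trace_mul_pow_sub_le (hτ : ∀ x y, τ (x * y) = τ (y * x)) (hε : 0 ≤ ε)
    (hκ : 1 ≤ κ) (hL : ‖L‖ ≤ κ) (hU : ‖U‖ ≤ κ)
    (hc : ∀ W, |τ (W * (U * L - L * U))| ≤ ε * ‖W‖) (p : ℕ) (W : R) :
    |τ (W * ((L * U) ^ p - L ^ p * U ^ p))| ≤ (p : ℝ) ^ 2 * ε * κ ^ (2 * p) * ‖W‖ := by
  induction p generalizing W with
  | zero => simp
  | succ p ih =>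
    have e : W * ((L * U) ^ (p + 1) - L ^ (p + 1) * U ^ (p + 1))
        = W * ((L * U) ^ p - L ^ p * U ^ p) * (L * U)
          + W * L ^ p * (U ^ p * L - L * U ^ p) * U := by
      rw [pow_succ, pow_succ, pow_succ]; noncomm_ring
    have hκ0 : 0 ≤ κ := by linarith
    have h1 : |τ (W * ((L * U) ^ p - L ^ p * U ^ p) * (L * U))|
        ≤ (p : ℝ) ^ 2 * ε * κ ^ (2 * p) * (κ * κ * ‖W‖) := by
      rw [hτ, ← mul_assoc]
      refine (ih _).trans ?_
      gcongr
      exact (norm_mul_le _ _).trans (by gcongr; exact (norm_mul_le _ _).trans (by gcongr))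
    have h2 : |τ (W * L ^ p * (U ^ p * L - L * U ^ p) * U)|
        ≤ p * ε * κ ^ p * (κ * (‖W‖ * κ ^ p)) := by
      rw [hτ, ← mul_assoc]
      refine (abs_trace_mul_pow_commutator_le hτ hε hκ hU hc p _).trans ?_
      gcongr
      refine (norm_mul_le _ _).trans ?_
      gcongr
      exact (norm_mul_le _ _).trans (by gcongr; exact norm_pow_le_of_norm_le hL p)
    rw [e, map_add]
    refine (abs_add_le _ _).trans ((add_le_add h1 h2).trans ?_)
    have e2 : κ ^ (2 * (p + 1)) = κ ^ (2 * p) * (κ * κ) := by ring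
    have e3 : p * ε * κ ^ p * (κ * (‖W‖ * κ ^ p)) = p * ε * ‖W‖ * κ ^ (2 * p) * κ := by ring
    have h4 : (p : ℝ) * ε * ‖W‖ * κ ^ (2 * p) * κ ≤ (p : ℝ) * ε * ‖W‖ * κ ^ (2 * p) * (κ * κ) := by
      gcongr
      nlinarith
    -- The increment available is `(p + 1) ^ 2 - p ^ 2 = 2 p + 1`.
    have h5 : (p : ℝ) * ε * ‖W‖ * κ ^ (2 * p) * (κ * κ)
        ≤ (2 * p + 1 : ℝ) * (ε * ‖W‖ * κ ^ (2 * p) * (κ * κ)) := by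
      have : 0 ≤ ε * ‖W‖ * κ ^ (2 * p) * (κ * κ) := by positivity
      nlinarith [Nat.cast_nonneg (α := ℝ) p]
    rw [e2, e3]
    push_cast
    nlinarith

end TraceCommutator

/-! ### Sums and asymptotics of falling factorials. -/

section FallingFactorial

open Polynomial

theorem eval_descPochhammer_succ_add_one (l : ℕ) (x : ℝ) :
    (descPochhammer ℝ (l + 1)).eval (x + 1) = (x + 1) * (descPochhammer ℝ l).eval x := by
  simp [descPochhammer_succ_left, eval_comp]

theorem eval_descPochhammer_of_lt {i l : ℕ} (h : i < l) :
    (descPochhammer ℝ l).eval (i : ℝ) = 0 := by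
  induction l, h using Nat.le_induction with
  | base => rw [descPochhammer_succ_eval, sub_self, mul_zero]
  | succ l _ ih => rw [descPochhammer_succ_eval, ih, zero_mul]

/-- The forward difference of `(x)_(l+1)` is `(l + 1) (x)_l`, so the sum telescopes. -/
theorem sum_eval_descPochhammer (l n : ℕ) :
    ∑ i ∈ Finset.range n, (descPochhammer ℝ l).eval (i : ℝ)
      = (descPochhammer ℝ (l + 1)).eval (n : ℝ) / (l + 1) := by
  have hl : (l : ℝ) + 1 ≠ 0 := by positivity
  induction n with
  | zero => simp [descPochhammer_succ_left]
  | succ n ih =>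
    rw [Finset.sum_range_succ, ih, eq_div_iff hl, add_mul, div_mul_cancel₀ _ hl]
    have := congrArg (eval (n : ℝ)) (descPochhammer_succ_comp_X_add_one l)
    simp only [eval_comp, eval_add, eval_X, eval_one, eval_mul, eval_C] at this
    push_cast
    rw [this]
    ring

theorem tendsto_eval_descPochhammer_div_pow {α : Type*} {F : Filter α} {u ν : α → ℝ} {s : ℝ}
    (hν : Tendsto ν F atTop) (hu : Tendsto (fun x => u x / ν x) F (𝓝 s)) (l : ℕ) :
    Tendsto (fun x => (descPochhammer ℝ l).eval (u x) / ν x ^ l) F (𝓝 (s ^ l)) := by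
  induction l with
  | zero => simpa using tendsto_const_nhds
  | succ l ih =>
    have h : Tendsto (fun x => (l : ℝ) / ν x) F (𝓝 0) := hν.const_div_atTop _
    have := ih.mul (hu.sub h)
    rw [sub_zero, ← pow_succ] at this
    refine this.congr fun x => ?_
    rw [descPochhammer_succ_eval, pow_succ, ← sub_div, div_mul_div_comm]

end FallingFactorial

/-! ### The truncated Jacobi matrix as a product of shift and derivative factors. -/

section JacobiMatrix

open Polynomial Matrix
open scoped Matrix.Norms.Operator

theorem Fin.sum_ite_val_eq (n c : ℕ) (g : ℕ → ℝ) :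
    (∑ k : Fin n, if (k : ℕ) = c then g k else 0) = if c < n then g c else 0 := by
  rw [Fin.sum_univ_eq_sum_range (fun k => if k = c then g k else 0) n, Finset.sum_ite_eq']
  simp

/-- The lower shift matrix. -/
def shiftMatrix (n : ℕ) : Matrix (Fin n) (Fin n) ℝ :=
  .of fun i j => if (i : ℕ) = j + 1 then 1 else 0

/-- The matrix of `h • d/dx` in the monomial basis. -/
def derivMatrix (n : ℕ) (h : ℝ) : Matrix (Fin n) (Fin n) ℝ :=
  .of fun i j => if (j : ℕ) = i + 1 then h * j else 0

theorem shiftMatrix_pow_apply (n l : ℕ) (i j : Fin n) :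
    (shiftMatrix n ^ l) i j = if (i : ℕ) = j + l then 1 else 0 := by
  induction l generalizing j with
  | zero => simp [Matrix.one_apply, Fin.ext_iff]
  | succ l ih =>
    rw [pow_succ, Matrix.mul_apply]
    have : ∀ k : Fin n, (shiftMatrix n ^ l) i k * shiftMatrix n k j
        = if (k : ℕ) = j + 1 then (if (i : ℕ) = (k : ℕ) + l then 1 else 0) else 0 := by
      intro k
      rw [ih]
      simp [shiftMatrix]
    rw [Finset.sum_congr rfl fun k _ => this k,
      Fin.sum_ite_val_eq n (j + 1) fun k => if (i : ℕ) = k + l then 1 else 0, ← ite_and]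
    refine if_congr ⟨fun h => by omega, fun h => ?_⟩ rfl rfl
    have := i.2
    omega

theorem derivMatrix_pow_apply (n l : ℕ) (h : ℝ) (i j : Fin n) :
    (derivMatrix n h ^ l) i j
      = if (j : ℕ) = i + l then h ^ l * (descPochhammer ℝ l).eval (j : ℝ) else 0 := by
  induction l generalizing j with
  | zero => simp [Matrix.one_apply, Fin.ext_iff, eq_comm]
  | succ l ih =>
    rw [pow_succ, Matrix.mul_apply]
    have : ∀ k : Fin n, (derivMatrix n h ^ l) i k * derivMatrix n h k j
        = if (k : ℕ) = i + l then (if (j : ℕ) = (k : ℕ) + 1 then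
            h ^ l * (descPochhammer ℝ l).eval ((k : ℕ) : ℝ) * (h * j) else 0) else 0 := by
      intro k
      rw [ih]
      simp only [derivMatrix, Matrix.of_apply]
      split_ifs <;> simp
    rw [Finset.sum_congr rfl fun k _ => this k,
      Fin.sum_ite_val_eq n (i + l) fun k => if (j : ℕ) = k + 1 then
            h ^ l * (descPochhammer ℝ l).eval (k : ℝ) * (h * j) else 0, ← ite_and]
    have hj := j.2
    by_cases hij : (j : ℕ) = i + (l + 1)
    · rw [if_pos ⟨by omega, by omega⟩, if_pos hij]
      have : (j : ℝ) = ((i + l : ℕ) : ℝ) + 1 := by rw [hij]; push_cast; ring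
      rw [this, eval_descPochhammer_succ_add_one]
      ring
    · rw [if_neg (by omega), if_neg hij]

/-- One factor raises the index by `j`, the other lowers it by `l`, so the diagonal vanishes unless
`j = l`. This is why squared binomial coefficients appear in `trace_pow_mul_pow`. -/
theorem trace_shiftMatrix_pow_mul_derivMatrix_pow (n j l : ℕ) (h : ℝ) :
    (shiftMatrix n ^ j * derivMatrix n h ^ l).trace
      = if j = l then h ^ l * ((descPochhammer ℝ (l + 1)).eval (n : ℝ) / (l + 1)) else 0 := by
  have : ∀ i k : Fin n, (shiftMatrix n ^ j) i k * (derivMatrix n h ^ l) k i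
      = if (i : ℕ) = k + l then
          (if j = l then h ^ l * (descPochhammer ℝ l).eval ((i : ℕ) : ℝ) else 0) else 0 := by
    intro i k
    rw [shiftMatrix_pow_apply, derivMatrix_pow_apply]
    by_cases h1 : (i : ℕ) = k + l
    · by_cases h2 : j = l
      · simp [h1, h2]
      · rw [if_neg h2, ite_self, if_neg (by omega), zero_mul]
    · simp [h1]
  simp only [Matrix.trace, Matrix.diag, Matrix.mul_apply, this]
  split_ifs with hjl
  swap
  · simp
  rw [← sum_eval_descPochhammer, Finset.mul_sum,
    ← Fin.sum_univ_eq_sum_range (fun i => h ^ l * (descPochhammer ℝ l).eval (i : ℝ))]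
  refine Finset.sum_congr rfl fun i _ => ?_
  by_cases hil : l ≤ i
  · have : ∀ k : Fin n, ((i : ℕ) = k + l) = ((k : ℕ) = i - l) := fun k => by
      rw [eq_iff_iff]; omega
    simp only [this]
    rw [Fin.sum_ite_val_eq n (i - l) fun _ => _, if_pos (by omega)]
  · rw [eval_descPochhammer_of_lt (not_le.1 hil)]
    simp

theorem trace_pow_mul_pow (n p : ℕ) (a h : ℝ) :
    ((shiftMatrix n + a • 1) ^ p * (derivMatrix n h + 1) ^ p).trace
      = ∑ j ∈ Finset.range (p + 1), (p.choose j : ℝ) ^ 2 * a ^ (p - j) *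
          (h ^ j * ((descPochhammer ℝ (j + 1)).eval (n : ℝ) / (j + 1))) := by
  have h1 : (shiftMatrix n + a • 1) ^ p
      = ∑ j ∈ Finset.range (p + 1), ((p.choose j : ℝ) * a ^ (p - j)) • shiftMatrix n ^ j := by
    rw [((Commute.one_right _).smul_right a).add_pow]
    refine Finset.sum_congr rfl fun j _ => ?_
    rw [_root_.smul_pow, one_pow, mul_smul_comm, mul_one, ← nsmul_eq_mul', mul_smul, Nat.cast_smul_eq_nsmul]
  have h2 : (derivMatrix n h + 1) ^ p
      = ∑ l ∈ Finset.range (p + 1), (p.choose l : ℝ) • derivMatrix n h ^ l := by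
    rw [(Commute.one_right _).add_pow]
    refine Finset.sum_congr rfl fun j _ => ?_
    rw [one_pow, mul_one, ← nsmul_eq_mul', Nat.cast_smul_eq_nsmul]
  rw [h1, h2, Finset.sum_mul, Matrix.trace_sum]
  refine Finset.sum_congr rfl fun j hj => ?_
  rw [Finset.mul_sum, Matrix.trace_sum, Finset.sum_eq_single j]
  · rw [smul_mul_smul_comm, Matrix.trace_smul, trace_shiftMatrix_pow_mul_derivMatrix_pow, if_pos rfl,
      smul_eq_mul]
    ring
  · intro l _ hl
    rw [smul_mul_smul_comm, Matrix.trace_smul, trace_shiftMatrix_pow_mul_derivMatrix_pow,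
      if_neg hl.symm, smul_zero]
  · exact fun h => absurd hj h

theorem Matrix.linfty_opNorm_le_of_row_sum {n : ℕ} {A : Matrix (Fin n) (Fin n) ℝ} {c : ℝ}
    (hc : 0 ≤ c) (h : ∀ i, ∑ j, |A i j| ≤ c) : ‖A‖ ≤ c := by
  rw [Matrix.linfty_opNorm_def]
  lift c to NNReal using hc
  refine NNReal.coe_le_coe.2 (Finset.sup_le fun i _ => ?_)
  rw [← NNReal.coe_le_coe]
  simpa using h i

theorem Matrix.abs_apply_le_linfty_opNorm {n : ℕ} (A : Matrix (Fin n) (Fin n) ℝ) (i j : Fin n) :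
    |A i j| ≤ ‖A‖ := by
  rw [Matrix.linfty_opNorm_def]
  have h1 : ‖A i j‖₊ ≤ ∑ j, ‖A i j‖₊ :=
    Finset.single_le_sum (f := fun j => ‖A i j‖₊) (fun _ _ => zero_le) (Finset.mem_univ j)
  have h2 := Finset.le_sup (f := fun i => ∑ j, ‖A i j‖₊) (Finset.mem_univ i)
  exact_mod_cast h1.trans h2

theorem norm_shiftMatrix_le (n : ℕ) : ‖shiftMatrix n‖ ≤ 1 := by
  refine Matrix.linfty_opNorm_le_of_row_sum zero_le_one fun i => ?_
  have : ∀ j : Fin n, |shiftMatrix n i j|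
      -- For `i = 0` the row is zero, and the truncated index only weakens the bound.
      ≤ if (j : ℕ) = i - 1 then (fun _ => (1 : ℝ)) (j : ℕ) else 0 := by
    intro j
    simp only [shiftMatrix, Matrix.of_apply]
    split_ifs with h1 h2
    · simp
    · omega
    · simp
    · simp
  refine (Finset.sum_le_sum fun j _ => this j).trans ?_
  rw [Fin.sum_ite_val_eq n (i - 1) fun _ => (1 : ℝ)]
  split_ifs <;> simp

theorem norm_derivMatrix_le (n : ℕ) {h : ℝ} (hh : 0 ≤ h) : ‖derivMatrix n h‖ ≤ h * n := by
  refine Matrix.linfty_opNorm_le_of_row_sum (by positivity) fun i => ?_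
  have : ∀ j : Fin n, |derivMatrix n h i j|
      ≤ if (j : ℕ) = i + 1 then (fun _ => (h * n : ℝ)) (j : ℕ) else 0 := by
    intro j
    simp only [derivMatrix, Matrix.of_apply]
    split_ifs with h1
    · rw [abs_of_nonneg (by positivity)]
      gcongr
      exact j.2.le
    · simp
  refine (Finset.sum_le_sum fun j _ => this j).trans ?_
  rw [Fin.sum_ite_val_eq n (i + 1) fun _ => (h * n : ℝ)]
  split_ifs
  · rfl
  · positivity

/-- The relation `[h d/dx, x] = h` holds except in the last diagonal entry, where truncation cuts
off the shift; that entry makes the trace zero. -/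
theorem derivMatrix_mul_shiftMatrix_sub (n : ℕ) (h : ℝ) :
    derivMatrix n h * shiftMatrix n - shiftMatrix n * derivMatrix n h
      = Matrix.diagonal fun i : Fin n => if (i : ℕ) + 1 < n then h else -(h * (n - 1)) := by
  ext i k
  have h1 : (derivMatrix n h * shiftMatrix n) i k
      = if (i : ℕ) + 1 < n ∧ i = k then h * ((i : ℝ) + 1) else 0 := by
    have : ∀ j : Fin n, derivMatrix n h i j * shiftMatrix n j k
        = if (j : ℕ) = i + 1 then (if (j : ℕ) = k + 1 then h * ((j : ℕ) : ℝ) else 0) else 0 := by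
      intro j
      simp only [shiftMatrix, derivMatrix, Matrix.of_apply]
      split_ifs <;> simp
    rw [Matrix.mul_apply, Finset.sum_congr rfl fun j _ => this j,
      Fin.sum_ite_val_eq n (i + 1) fun j => if j = (k : ℕ) + 1 then h * (j : ℝ) else 0, ← ite_and]
    simp [Fin.ext_iff]
  have h2 : (shiftMatrix n * derivMatrix n h) i k = if i = k then h * (i : ℝ) else 0 := by
    have hi := i.2
    have : ∀ j : Fin n, shiftMatrix n i j * derivMatrix n h j k
        = if (j : ℕ) = i - 1 then (if i = k then h * (i : ℝ) else 0) else 0 := by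
      intro j
      simp only [shiftMatrix, derivMatrix, Matrix.of_apply, Fin.ext_iff]
      by_cases h1 : (i : ℕ) = j + 1
      · by_cases h2 : (k : ℕ) = j + 1
        · rw [if_pos h1, if_pos h2, if_pos (by omega), if_pos (by omega), h1, h2]; simp
        · rw [if_neg h2, if_neg (by omega : ¬ (i : ℕ) = k)]; simp
      · by_cases h3 : (i : ℕ) = 0
        · simp [h3]
        · rw [if_neg h1, if_neg (by omega : ¬ (j : ℕ) = i - 1), zero_mul]
    rw [Matrix.mul_apply, Finset.sum_congr rfl fun j _ => this j,
      Fin.sum_ite_val_eq n (i - 1) fun _ => _, if_pos (by omega)]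
  rw [Matrix.sub_apply, h1, h2, Matrix.diagonal_apply]
  have hi := i.2
  by_cases hik : i = k
  · by_cases hin : (i : ℕ) + 1 < n
    · rw [if_pos ⟨hin, hik⟩, if_pos hik, if_pos hik, if_pos hin]; ring
    · have : (n : ℝ) = (i : ℝ) + 1 := by exact_mod_cast (by omega : n = (i : ℕ) + 1)
      rw [if_neg fun h => hin h.1, if_pos hik, if_pos hik, if_neg hin, this]
      ring
  · simp [hik]

/-- The diagonal entries of size `h` contribute at most `h n`, and the corner entry at most another
`h n`. The result stays bounded when `h n` converges. -/
theorem abs_trace_mul_commutator_le (n : ℕ) {a h : ℝ} (hh : 0 ≤ h) (W : Matrix (Fin n) (Fin n) ℝ) :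
    |(W * ((derivMatrix n h + 1) * (shiftMatrix n + a • 1)
      - (shiftMatrix n + a • 1) * (derivMatrix n h + 1))).trace| ≤ 2 * (h * n) * ‖W‖ := by
  have e : (derivMatrix n h + 1) * (shiftMatrix n + a • 1)
      - (shiftMatrix n + a • 1) * (derivMatrix n h + 1)
      = derivMatrix n h * shiftMatrix n - shiftMatrix n * derivMatrix n h := by
    simp only [add_mul, mul_add, mul_one, one_mul, mul_smul_comm, smul_mul_assoc, smul_add]
    abel
  rw [e, derivMatrix_mul_shiftMatrix_sub]
  simp only [Matrix.trace, Matrix.diag, Matrix.mul_diagonal]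
  refine (Finset.abs_sum_le_sum_abs _ _).trans ?_
  have hb : ∀ i : Fin n, |W i i * (if (i : ℕ) + 1 < n then h else -(h * (n - 1)))|
      ≤ ‖W‖ * (h + if (i : ℕ) = n - 1 then (fun _ => h * n) (i : ℕ) else 0) := by
    intro i
    have hi := i.2
    have hn : (1 : ℝ) ≤ n := by exact_mod_cast (by omega : 1 ≤ n)
    rw [abs_mul]
    gcongr
    · exact W.abs_apply_le_linfty_opNorm i i
    · split_ifs with h1 h2
      · omega
      · rw [abs_of_nonneg hh, add_zero]
      · rw [abs_neg, abs_of_nonneg (mul_nonneg hh (by linarith))]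
        nlinarith
      · omega
  refine (Finset.sum_le_sum fun i _ => hb i).trans ?_
  rw [← Finset.mul_sum, Finset.sum_add_distrib, Fin.sum_ite_val_eq n (n - 1) fun _ => h * n]
  have : (if n - 1 < n then h * (n : ℝ) else 0) ≤ h * n := by
    split_ifs
    · rfl
    · positivity
  simp only [Finset.sum_const, Finset.card_univ, Fintype.card_fin, nsmul_eq_mul]
  nlinarith [norm_nonneg W]

/-- The trace of the `p`-th power of the truncated Jacobi matrix, up to a bounded error. -/
theorem abs_trace_jacobi_pow_sub_le {n : ℕ} (hn : 0 < n) {a h κ : ℝ} (ha : 0 ≤ a) (hh : 0 ≤ h)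
    (h1 : 1 + a ≤ κ) (h2 : 1 + h * n ≤ κ) (p : ℕ) :
    |(((shiftMatrix n + a • 1) * (derivMatrix n h + 1)) ^ p).trace
      - ∑ j ∈ Finset.range (p + 1), (p.choose j : ℝ) ^ 2 * a ^ (p - j) *
          (h ^ j * ((descPochhammer ℝ (j + 1)).eval (n : ℝ) / (j + 1)))|
      ≤ (p : ℝ) ^ 2 * (2 * (h * n)) * κ ^ (2 * p) := by
  have : Nonempty (Fin n) := ⟨⟨0, hn⟩⟩
  have key := abs_trace_mul_pow_sub_le (τ := Matrix.traceAddMonoidHom (Fin n) ℝ)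
    (L := shiftMatrix n + a • 1) (U := derivMatrix n h + 1) (ε := 2 * (h * n)) (κ := κ)
    (fun x y => Matrix.trace_mul_comm x y) (by positivity) (by linarith) ?_ ?_
    (fun W => abs_trace_mul_commutator_le n hh W) p 1
  · rw [norm_one, mul_one, one_mul] at key
    rw [← trace_pow_mul_pow, ← Matrix.trace_sub]
    exact key
  · refine (norm_add_le _ _).trans ?_
    have := norm_shiftMatrix_le n
    rw [norm_smul, norm_one, mul_one, Real.norm_of_nonneg ha]
    linarith
  · refine (norm_add_le _ _).trans ?_
    have := norm_derivMatrix_le n hh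
    rw [norm_one]
    linarith

end JacobiMatrix

/-! ### Moments and size of the scaled Charlier zeros. -/

section CharlierMoments

open Polynomial Matrix
open scoped Matrix.Norms.Operator

/-- The three-term recurrence of the Charlier polynomials: write `X = (X - b) + b` in
`X_mul_umbral`. The truncated `k - 1` is harmless, its coefficient being zero at `k = 0`. -/
theorem X_mul_umbral_pow (b : ℝ) (k : ℕ) :
    X * umbral ((X - C b) ^ k) = umbral ((X - C b) ^ (k + 1)) + (k + b) • umbral ((X - C b) ^ k)
      + (k * b) • umbral ((X - C b) ^ (k - 1)) := by
  have h : X * (X - C b) ^ k + X * derivative ((X - C b) ^ k) = (X - C b) ^ (k + 1)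
      + ((k : ℝ) + b) • (X - C b) ^ k + ((k : ℝ) * b) • (X - C b) ^ (k - 1) := by
    rw [derivative_X_sub_C_pow]
    cases k with
    | zero => simp [smul_eq_C_mul]
    | succ k =>
      simp only [smul_eq_C_mul, Nat.add_sub_cancel, map_add, map_mul, map_natCast]
      ring
  rw [X_mul_umbral, ← map_add, h]
  simp only [map_add, map_smul]

theorem exists_spacedRoots_umbral_pow {b : ℝ} (hb : 0 < b) (k : ℕ) :
    ∃ y : ℕ → ℝ, SpacedRoots (umbral ((X - C b) ^ k)) k y := by
  obtain ⟨y, hy⟩ := exists_spacedRoots_umbral (Multiset.replicate k b)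
    fun c hc => by rwa [Multiset.eq_of_mem_replicate hc]
  simp only [Multiset.map_replicate, Multiset.prod_replicate, Multiset.card_replicate] at hy
  exact ⟨y, hy⟩

/-- The left eigenvectors of the Jacobi matrix are the rows of values at a zero. -/
noncomputable def charlierEval (n : ℕ) (b h : ℝ) (x : ℕ → ℝ) : Matrix (Fin n) (Fin n) ℝ :=
  .of fun i k => (umbral ((X - C b) ^ (k : ℕ))).eval (x i) * h ^ (k : ℕ)

variable {n : ℕ} {a h : ℝ} {x : ℕ → ℝ}

/-- Expanding the product of the two factors reproduces the recurrence for `b = a / h`, scaled by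
powers of `h`. The term of degree `n` lost by truncation vanishes at the zeros `x i`. -/
theorem charlierEval_mul_jacobi (hh : h ≠ 0)
    (hx : SpacedRoots (umbral ((X - C (a / h)) ^ n)) n x) :
    charlierEval n (a / h) h x * ((shiftMatrix n + a • 1) * (derivMatrix n h + 1))
      = Matrix.diagonal (fun i : Fin n => h * x i) * charlierEval n (a / h) h x := by
  set c : ℕ → ℝ[X] := fun k => umbral ((X - C (a / h)) ^ k) with hc
  have hS : ∀ i k : Fin n, (charlierEval n (a / h) h x * shiftMatrix n) i k
      = (c (k + 1)).eval (x i) * h ^ ((k : ℕ) + 1) := by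
    intro i k
    rw [Matrix.mul_apply]
    have : ∀ l : Fin n, charlierEval n (a / h) h x i l * shiftMatrix n l k
        = if (l : ℕ) = k + 1 then (c l).eval (x i) * h ^ (l : ℕ) else 0 := by
      intro l
      simp [charlierEval, shiftMatrix, hc]
    rw [Finset.sum_congr rfl fun l _ => this l,
      Fin.sum_ite_val_eq n (k + 1) fun l => (c l).eval (x i) * h ^ l]
    split_ifs with hk
    · rfl
    · have : (k : ℕ) + 1 = n := by omega
      rw [this, hc]
      simp only
      rw [hx.eval_root i.2, zero_mul]
  have hD : ∀ (A : Matrix (Fin n) (Fin n) ℝ) (v : ℕ → ℝ) (i k : Fin n),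
      (∀ l : Fin n, A i l = v l) → (A * derivMatrix n h) i k = v (k - 1) * (h * k) := by
    intro A v i k hA
    rw [Matrix.mul_apply]
    have : ∀ l : Fin n, A i l * derivMatrix n h l k
        = if (l : ℕ) = k - 1 then v l * (h * k) else 0 := by
      intro l
      rw [hA]
      simp only [derivMatrix, Matrix.of_apply]
      by_cases h1 : (k : ℕ) = l + 1
      · rw [if_pos h1, if_pos (by omega)]
      · rw [if_neg h1]
        by_cases h2 : (l : ℕ) = k - 1
        · rw [if_pos h2, (by omega : (k : ℕ) = 0)]
          simp
        · rw [if_neg h2, mul_zero]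
    rw [Finset.sum_congr rfl fun l _ => this l,
      Fin.sum_ite_val_eq n (k - 1) fun l => v l * (h * k), if_pos (by omega)]
  have e : charlierEval n (a / h) h x * ((shiftMatrix n + a • 1) * (derivMatrix n h + 1))
      = charlierEval n (a / h) h x * shiftMatrix n * derivMatrix n h
        + charlierEval n (a / h) h x * shiftMatrix n
        + a • (charlierEval n (a / h) h x * derivMatrix n h) + a • charlierEval n (a / h) h x := by
    simp only [add_mul, mul_add, mul_one, one_mul, mul_smul_comm, smul_mul_assoc, mul_assoc]
    abel
  ext i k
  rw [e, Matrix.add_apply, Matrix.add_apply, Matrix.add_apply, Matrix.smul_apply,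
    Matrix.smul_apply, hS, hD _ (fun l => (c (l + 1)).eval (x i) * h ^ (l + 1)) i k (hS i),
    hD _ (fun l => (c l).eval (x i) * h ^ l) i k (fun l => rfl), Matrix.diagonal_mul]
  have hrec := congrArg (eval (x i)) (X_mul_umbral_pow (a / h) k)
  simp only [eval_mul, eval_X, eval_add, eval_smul, smul_eq_mul] at hrec
  have hV : charlierEval n (a / h) h x i k = (c k).eval (x i) * h ^ (k : ℕ) := rfl
  rw [hV, smul_eq_mul, smul_eq_mul, mul_assoc h, ← mul_assoc (x i), hrec]
  rcases Nat.eq_zero_or_pos (k : ℕ) with hk | hk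
  · simp only [hk, hc]
    field_simp
    simp
    ring
  · obtain ⟨m, hm⟩ : ∃ m, (k : ℕ) = m + 1 := ⟨k - 1, by omega⟩
    simp only [hm, hc, Nat.add_sub_cancel]
    field_simp
    ring

/-- Values of monic polynomials of degrees `0, …, n - 1` at distinct points have the Vandermonde
determinant. -/
theorem isUnit_det_charlierEval (ha : 0 < a) (hh : 0 < h)
    (hx : SpacedRoots (umbral ((X - C (a / h)) ^ n)) n x) :
    IsUnit (charlierEval n (a / h) h x).det := by
  have e : charlierEval n (a / h) h x
      = Matrix.of (fun i k : Fin n => (umbral ((X - C (a / h)) ^ (k : ℕ))).eval (x i))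
        * Matrix.diagonal fun k : Fin n => h ^ (k : ℕ) := by
    ext i k
    simp [charlierEval]
  rw [e, Matrix.det_mul, Matrix.det_diagonal,
    ← det_eval_matrixOfPolynomials_eq_det_vandermonde (fun i : Fin n => x i)
      (fun k : Fin n => umbral ((X - C (a / h)) ^ (k : ℕ)))]
  · refine IsUnit.mk0 _ (mul_ne_zero (Matrix.det_vandermonde_ne_zero_iff.2 fun i j hij => ?_) ?_)
    · rcases lt_trichotomy (i : ℕ) j with hlt | heq | hlt
      · linarith [hx.lt_add_one_le hlt j.2]
      · exact Fin.ext heq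
      · linarith [hx.lt_add_one_le hlt i.2]
    · exact Finset.prod_ne_zero_iff.2 fun k _ => by positivity
  · intro k
    obtain ⟨y, hy⟩ := exists_spacedRoots_umbral_pow (div_pos ha hh) k
    exact hy.natDegree
  · intro k
    obtain ⟨y, hy⟩ := exists_spacedRoots_umbral_pow (div_pos ha hh) k
    exact hy.monic

theorem jacobi_eq_conj (ha : 0 < a) (hh : 0 < h)
    (hx : SpacedRoots (umbral ((X - C (a / h)) ^ n)) n x) :
    (shiftMatrix n + a • 1) * (derivMatrix n h + 1)
      = (charlierEval n (a / h) h x)⁻¹ * Matrix.diagonal (fun i : Fin n => h * x i)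
        * charlierEval n (a / h) h x := by
  have hu := isUnit_det_charlierEval ha hh hx
  rw [mul_assoc, ← charlierEval_mul_jacobi hh.ne' hx, Matrix.nonsing_inv_mul_cancel_left _ _ hu]

theorem trace_jacobi_pow (ha : 0 < a) (hh : 0 < h)
    (hx : SpacedRoots (umbral ((X - C (a / h)) ^ n)) n x) (p : ℕ) :
    (((shiftMatrix n + a • 1) * (derivMatrix n h + 1)) ^ p).trace
      = ∑ i ∈ Finset.range n, (h * x i) ^ p := by
  have hu := isUnit_det_charlierEval ha hh hx
  set V := charlierEval n (a / h) h x
  have hpow : ((shiftMatrix n + a • 1) * (derivMatrix n h + 1)) ^ p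
      = V⁻¹ * Matrix.diagonal (fun i : Fin n => (h * x i) ^ p) * V := by
    induction p with
    | zero => simp [Matrix.nonsing_inv_mul _ hu]
    | succ p ih =>
      rw [pow_succ, ih, jacobi_eq_conj ha hh hx]
      calc V⁻¹ * Matrix.diagonal (fun i : Fin n => (h * x i) ^ p) * V
            * (V⁻¹ * Matrix.diagonal (fun i : Fin n => h * x i) * V)
          = V⁻¹ * (Matrix.diagonal (fun i : Fin n => (h * x i) ^ p) * (V * V⁻¹)
            * Matrix.diagonal (fun i : Fin n => h * x i)) * V := by
              simp only [mul_assoc]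
        _ = _ := by
              rw [Matrix.mul_nonsing_inv _ hu, mul_one, Matrix.diagonal_mul_diagonal]
              simp only [pow_succ]
  rw [hpow, Matrix.trace_mul_comm, Matrix.mul_nonsing_inv_cancel_left _ _ hu,
    Matrix.trace_diagonal, Fin.sum_univ_eq_sum_range (fun i => (h * x i) ^ p)]

/-- An eigenvalue is at most the operator norm; the eigenvector is a column of the inverse of
`charlierEval`. This confines the scaled zeros to a fixed interval. -/
theorem mul_root_le_norm_jacobi (ha : 0 < a) (hh : 0 < h)
    (hx : SpacedRoots (umbral ((X - C (a / h)) ^ n)) n x) {i : ℕ} (hi : i < n) :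
    h * x i ≤ (1 + a) * (1 + h * n) := by
  have hu := isUnit_det_charlierEval ha hh hx
  have hconj := jacobi_eq_conj ha hh hx
  have : Nonempty (Fin n) := ⟨⟨i, hi⟩⟩
  have hL : ‖shiftMatrix n + a • 1‖ ≤ 1 + a := by
    refine (norm_add_le _ _).trans ?_
    have := norm_shiftMatrix_le n
    rw [norm_smul, norm_one, mul_one, Real.norm_of_nonneg ha.le]
    linarith
  have hU : ‖derivMatrix n h + 1‖ ≤ 1 + h * n := by
    refine (norm_add_le _ _).trans ?_
    have := norm_derivMatrix_le n hh.le
    rw [norm_one]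
    linarith
  set V := charlierEval n (a / h) h x
  set B := (shiftMatrix n + a • 1) * (derivMatrix n h + 1) with hB
  set e : Fin n → ℝ := Pi.single ⟨i, hi⟩ 1 with he
  set u := V⁻¹ *ᵥ e with hu'
  have hBu : B *ᵥ u = (h * x i) • u := by
    rw [hconj, hu', Matrix.mulVec_mulVec, mul_assoc, Matrix.mul_nonsing_inv _ hu, mul_one,
      ← Matrix.mulVec_mulVec, he, Matrix.diagonal_mulVec_single, ← Matrix.mulVec_smul]
    congr 1
    ext k
    simp [Pi.single_apply]
  have hu0 : u ≠ 0 := by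
    intro h0
    have : V *ᵥ u = e := by
      rw [hu', Matrix.mulVec_mulVec, Matrix.mul_nonsing_inv _ hu, Matrix.one_mulVec]
    rw [h0, Matrix.mulVec_zero] at this
    have := congrFun this ⟨i, hi⟩
    simp [he] at this
  have h1 := Matrix.linfty_opNorm_mulVec B u
  rw [hBu, norm_smul] at h1
  have h2 := le_of_mul_le_mul_right h1 (norm_pos_iff.2 hu0)
  refine (le_abs_self _).trans (h2.trans ((norm_mul_le _ _).trans ?_))
  exact mul_le_mul hL hU (norm_nonneg _) (by linarith)

/-- The moments of the limit distribution of the zeros of the Charlier polynomials. -/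
noncomputable def charlierMoment (a s : ℝ) (p : ℕ) : ℝ :=
  ∑ j ∈ Finset.range (p + 1), (p.choose j : ℝ) ^ 2 * a ^ (p - j) * (s ^ j / (j + 1))

/-- The trace error is bounded, so division by `n` removes it; in the main term `(n)_(j+1) / (n ν ^
j)` tends to `s ^ j`. -/
theorem tendsto_charlier_moment {α : Type*} {F : Filter α} {n : α → ℕ} {ν : α → ℝ}
    {a s : ℝ} (ha : 0 < a) (hs : 0 < s) (hν : Tendsto ν F atTop)
    (hnν : Tendsto (fun i => (n i : ℝ) / ν i) F (𝓝 s)) {x : α → ℕ → ℝ}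
    (hx : ∀ᶠ i in F, SpacedRoots (umbral ((X - C (ν i * a)) ^ n i)) (n i) (x i)) (p : ℕ) :
    Tendsto (fun i => 1 / (n i : ℝ) * ∑ k ∈ Finset.range (n i), (x i k / ν i) ^ p) F
      (𝓝 (charlierMoment a s p)) := by
  -- Eventually dominates both factor norms, since `n i / ν i < s + 1`.
  set κ := 1 + a + (1 + (s + 1))
  set T : α → ℝ := fun i => ∑ j ∈ Finset.range (p + 1), (p.choose j : ℝ) ^ 2 * a ^ (p - j) *
          ((1 / ν i) ^ j * ((descPochhammer ℝ (j + 1)).eval (n i : ℝ) / (j + 1))) with hT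
  have hν0 : ∀ᶠ i in F, 0 < ν i := hν.eventually_gt_atTop 0
  have hn0 : ∀ᶠ i in F, 0 < (n i : ℝ) / ν i := hnν.eventually (lt_mem_nhds hs)
  have hn1 : ∀ᶠ i in F, (n i : ℝ) / ν i < s + 1 := hnν.eventually (gt_mem_nhds (by linarith))
  have hmain : Tendsto (fun i => 1 / (n i : ℝ) * T i) F (𝓝 (charlierMoment a s p)) := by
    have : ∀ j : ℕ, Tendsto (fun i => (p.choose j : ℝ) ^ 2 * a ^ (p - j) *
        ((descPochhammer ℝ (j + 1)).eval (n i : ℝ) / ν i ^ (j + 1) / ((n i : ℝ) / ν i) / (j + 1))) F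
        (𝓝 ((p.choose j : ℝ) ^ 2 * a ^ (p - j) * (s ^ (j + 1) / s / (j + 1)))) := fun j =>
      (((tendsto_eval_descPochhammer_div_pow hν hnν (j + 1)).div hnν hs.ne').div_const _).const_mul _
    have h := tendsto_finsetSum (Finset.range (p + 1)) fun j _ => this j
    have e : ∀ j, s ^ (j + 1) / s = s ^ j := fun j => by rw [pow_succ]; field_simp
    simp only [e] at h
    refine h.congr' ?_
    filter_upwards [hν0, hn0] with i hi hi'
    have hni : (n i : ℝ) ≠ 0 := by
      intro h0
      rw [h0, zero_div] at hi'
      exact hi'.false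
    rw [hT]
    simp only [Finset.mul_sum]
    refine Finset.sum_congr rfl fun j _ => ?_
    have := hi.ne'
    rw [_root_.one_div_pow]
    field_simp
    ring
  have hnat : Tendsto (fun i => (n i : ℝ)) F atTop := by
    refine (hν.atTop_mul_pos hs hnν).congr' ?_
    filter_upwards [hν0] with i hi
    field_simp
  have hsmall : Tendsto (fun i => 1 / (n i : ℝ) *
      ((p : ℝ) ^ 2 * (2 * (s + 1)) * κ ^ (2 * p))) F (𝓝 0) := by
    simpa using (hnat.const_div_atTop 1).mul_const ((p : ℝ) ^ 2 * (2 * (s + 1)) * κ ^ (2 * p))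
  rw [← tendsto_sub_nhds_zero_iff] at hmain ⊢
  have hdiff : Tendsto (fun i => 1 / (n i : ℝ) * ∑ k ∈ Finset.range (n i), (x i k / ν i) ^ p
      - 1 / (n i : ℝ) * T i) F (𝓝 0) := by
    refine squeeze_zero_norm' ?_ hsmall
    filter_upwards [hν0, hn0, hn1, hx] with i hi hi' hi'' hxi
    have hni : 0 < n i := by
      rcases Nat.eq_zero_or_pos (n i) with h0 | h0
      · simp [h0] at hi'
      · exact h0
    have hb : a / (1 / ν i) = ν i * a := by field_simp
    have e1 : 1 / ν i * (n i : ℝ) = n i / ν i := by ring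
    have htr := trace_jacobi_pow (h := 1 / ν i) ha (by positivity) (by rw [hb]; exact hxi) p
    have := abs_trace_jacobi_pow_sub_le hni ha.le (h := 1 / ν i) (κ := κ) (by positivity)
      (by simp only [κ]; linarith) (by rw [e1]; simp only [κ]; linarith) p
    rw [htr, e1] at this
    rw [← mul_sub, norm_mul, Real.norm_of_nonneg (by positivity), Real.norm_eq_abs]
    refine mul_le_mul_of_nonneg_left ?_ (by positivity)
    simp only [one_div_mul_eq_div] at this
    refine this.trans ?_
    have hκ : 0 ≤ κ := by simp only [κ]; linarith
    gcongr
  simpa using hdiff.add hmain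

theorem charlier_root_div_le {n : ℕ} {ν a s : ℝ} (ha : 0 < a) (hν : 0 < ν) (hs : n / ν ≤ s)
    {x : ℕ → ℝ} (hx : SpacedRoots (umbral ((X - C (ν * a)) ^ n)) n x) {i : ℕ} (hi : i < n) :
    x i / ν ≤ (1 + a) * (1 + s) := by
  have hb : a / (1 / ν) = ν * a := by field_simp
  have := mul_root_le_norm_jacobi (h := 1 / ν) ha (by positivity) (by rw [hb]; exact hx) hi
  rw [one_div_mul_eq_div, one_div_mul_eq_div] at this
  refine this.trans ?_
  gcongr

end CharlierMoments

/-! ### A uniform point in a disc and the arccosine law. -/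

section DiscIntegral

theorem integral_exp_int_mul_I (k : ℤ) :
    ∫ θ in (-Real.pi)..Real.pi, Complex.exp ((k * Complex.I) * (θ : ℂ))
      = if k = 0 then 2 * (Real.pi : ℂ) else 0 := by
  split_ifs with hk
  · simp [hk]; ring
  · rw [integral_exp_mul_complex (mul_ne_zero (Int.cast_ne_zero.2 hk) Complex.I_ne_zero),
      Complex.exp_eq_exp_iff_exists_int.2 ⟨k, ?_⟩, sub_self, zero_div]
    push_cast
    ring

/-- The base is `|r e^{iθ} + c| ^ 2`; expand both conjugate factors, and only the terms with equal
exponents survive integration. -/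
theorem integral_trig_pow (r c : ℝ) (p : ℕ) :
    ∫ θ in (-Real.pi)..Real.pi, (r ^ 2 + c ^ 2 + 2 * r * c * Real.cos θ) ^ p
      = 2 * Real.pi * ∑ j ∈ Finset.range (p + 1),
          (p.choose j : ℝ) ^ 2 * (c ^ 2) ^ (p - j) * (r ^ 2) ^ j := by
  have h : ∀ θ : ℝ, (((r ^ 2 + c ^ 2 + 2 * r * c * Real.cos θ) ^ p : ℝ) : ℂ)
      = ∑ j ∈ Finset.range (p + 1), ∑ l ∈ Finset.range (p + 1),
        ((p.choose j : ℂ) * (p.choose l : ℂ) * (r : ℂ) ^ (j + l) * (c : ℂ) ^ (p - j + (p - l)))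
          * Complex.exp ((((j : ℤ) - (l : ℤ) : ℤ) * Complex.I) * (θ : ℂ)) := by
    intro θ
    have e : ((r ^ 2 + c ^ 2 + 2 * r * c * Real.cos θ : ℝ) : ℂ)
        = (r * Complex.exp (θ * Complex.I) + c) * (r * Complex.exp (-θ * Complex.I) + c) := by
      have h1 : Complex.exp (θ * Complex.I) * Complex.exp (-θ * Complex.I) = 1 := by
        rw [← Complex.exp_add]; simp
      have h2 : 2 * Complex.cos θ = Complex.exp (θ * Complex.I) + Complex.exp (-θ * Complex.I) := by
        rw [Complex.cos]; ring
      push_cast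
      linear_combination (r : ℂ) * c * h2 - (r : ℂ) ^ 2 * h1
    rw [Complex.ofReal_pow, e, mul_pow, add_pow, add_pow, Finset.sum_mul_sum]
    refine Finset.sum_congr rfl fun j _ => Finset.sum_congr rfl fun l _ => ?_
    have e2 : Complex.exp ((((j : ℤ) - (l : ℤ) : ℤ) * Complex.I) * (θ : ℂ))
        = Complex.exp (θ * Complex.I) ^ j * Complex.exp (-θ * Complex.I) ^ l := by
      rw [← Complex.exp_nat_mul, ← Complex.exp_nat_mul, ← Complex.exp_add]
      congr 1
      push_cast
      ring
    rw [e2]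
    ring
  have hint : ∀ (A : ℂ) (k : ℤ), IntervalIntegrable
      (fun θ : ℝ => A * Complex.exp ((k * Complex.I) * (θ : ℂ))) volume (-Real.pi) Real.pi :=
    fun A k => Continuous.intervalIntegrable (by fun_prop) _ _
  apply Complex.ofReal_injective
  rw [← intervalIntegral.integral_ofReal]
  simp only [h]
  rw [intervalIntegral.integral_finsetSum fun j _ =>
    Continuous.intervalIntegrable (by fun_prop) _ _]
  rw [Complex.ofReal_mul, Complex.ofReal_sum, Finset.mul_sum]
  refine Finset.sum_congr rfl fun j hj => ?_
  rw [intervalIntegral.integral_finsetSum fun l _ => hint _ _, Finset.sum_eq_single j]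
  · rw [intervalIntegral.integral_const_mul, integral_exp_int_mul_I, if_pos (sub_self _)]
    push_cast
    ring
  · intro l _ hl
    rw [intervalIntegral.integral_const_mul, integral_exp_int_mul_I, if_neg (by omega), mul_zero]
  · exact fun h => absurd hj h

/-- No bound on `k` is needed: `arccos` is `π` below `-1` and `0` above `1`, giving the full
interval and the empty set. -/
theorem setOf_lt_cos (k : ℝ) :
    {θ | θ ∈ Ioo (-Real.pi) Real.pi ∧ k < Real.cos θ} = Ioo (-Real.arccos k) (Real.arccos k) := by
  ext θ
  have hle := Real.arccos_le_pi k
  have h0 := Real.arccos_nonneg k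
  simp only [Set.mem_ofPred_eq, mem_Ioo, ← abs_lt]
  constructor
  · rintro ⟨h1, h2⟩
    by_contra! h3
    rw [← Real.cos_abs] at h2
    have h4 := Real.cos_le_cos_of_nonneg_of_le_pi h0 h1.le h3
    rcases lt_or_ge k (-1) with hk | hk
    · rw [Real.arccos_of_le_neg_one hk.le] at h3
      linarith
    · rcases le_or_gt k 1 with hk' | hk'
      · rw [Real.cos_arccos hk hk'] at h4
        linarith
      · linarith [Real.cos_le_one |θ|]
  · intro h1
    refine ⟨h1.trans_le hle, ?_⟩
    rw [← Real.cos_abs]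
    have h4 := Real.cos_lt_cos_of_nonneg_of_le_pi (abs_nonneg θ) hle h1
    rcases lt_or_ge k (-1) with hk | hk
    · linarith [Real.neg_one_le_cos |θ|]
    · rcases le_or_gt k 1 with hk' | hk'
      · rwa [Real.cos_arccos hk hk'] at h4
      · rw [Real.arccos_of_one_le hk'.le] at h1
        linarith [abs_nonneg θ]

/-- Polar coordinates for a bounded function that vanishes off a disc. -/
theorem integral_eq_polar_iterated {f : ℝ × ℝ → ℝ} (hf : Measurable f) {ρ M : ℝ}
    (hM : ∀ w, |f w| ≤ M) (hρ : ∀ r θ, ρ < r → f (r * Real.cos θ, r * Real.sin θ) = 0) :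
    ∫ w, f w = ∫ r in Ioi (0 : ℝ), ∫ θ in (-Real.pi)..Real.pi,
      r * f (r * Real.cos θ, r * Real.sin θ) := by
  rw [← integral_comp_polarCoord_symm, polarCoord_target]
  have hint : IntegrableOn (fun p : ℝ × ℝ => p.1 • f (polarCoord.symm p))
      (Ioi 0 ×ˢ Ioo (-Real.pi) Real.pi) (volume.prod volume) := by
    have hmeas : Measurable fun p : ℝ × ℝ => p.1 • f (p.1 * Real.cos p.2, p.1 * Real.sin p.2) := by
      fun_prop
    refine IntegrableOn.of_forall_sdiff_eq_zero (s := Ioc 0 ρ ×ˢ Ioo (-Real.pi) Real.pi) ?_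
      (measurableSet_Ioi.prod measurableSet_Ioo) ?_
    · refine Measure.integrableOn_of_bounded (M := ρ * M) ?_ hmeas.aestronglyMeasurable ?_
      · rw [Measure.prod_prod]
        exact ENNReal.mul_ne_top (by simp) (by simp)
      · refine (ae_restrict_iff' (measurableSet_Ioc.prod measurableSet_Ioo)).2
          (Eventually.of_forall fun p hp => ?_)
        rw [norm_smul, Real.norm_of_nonneg hp.1.1.le]
        exact mul_le_mul hp.1.2 (hM _) (abs_nonneg _) (hp.1.1.le.trans hp.1.2)
    · rintro ⟨r, θ⟩ ⟨⟨h1, h2⟩, h3⟩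
      have : ρ < r := by
        by_contra! h4
        exact h3 ⟨⟨h1, h4⟩, h2⟩
      simp [polarCoord_symm_apply, hρ r θ this]
  rw [Measure.volume_eq_prod, setIntegral_prod _ hint]
  refine setIntegral_congr_fun measurableSet_Ioi fun r _ => ?_
  simp only [polarCoord_symm_apply, smul_eq_mul]
  rw [intervalIntegral.integral_of_le (by linarith [Real.pi_pos]), integral_Ioc_eq_integral_Ioo]

theorem integral_Ioi_mul_comp_sq (g : ℝ → ℝ) :
    ∫ r in Ioi (0 : ℝ), 2 * r * g (r ^ 2) = ∫ y in Ioi (0 : ℝ), g y := by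
  rw [← integral_comp_rpow_Ioi_of_pos (g := g) (p := 2) (by norm_num)]
  refine setIntegral_congr_fun measurableSet_Ioi fun r _ => ?_
  norm_num

/-- The angular description of the disc shows that the law of `|w + √a| ^ 2`, with `w` uniform in
the disc of radius `√s`, has an arccosine density. -/
theorem integral_arccos_mul_pow {a s : ℝ} (ha : 0 < a) (hs : 0 < s) (p : ℕ) :
    ∫ z in Ioi (0 : ℝ), Real.arccos ((z + a - s) / (2 * √(a * z))) * z ^ p
      = Real.pi * s * charlierMoment a s p := by
  set c := √a with hc
  have hc0 : 0 < c := Real.sqrt_pos.2 ha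
  have hca : c ^ 2 = a := Real.sq_sqrt ha.le
  have hs2 : √s ^ 2 = s := Real.sq_sqrt hs.le
  set f : ℝ × ℝ → ℝ := fun w => if w.1 ^ 2 + w.2 ^ 2 < s then ((w.1 + c) ^ 2 + w.2 ^ 2) ^ p else 0
    with hf
  have hmeas : Measurable f := by
    refine Measurable.ite (measurableSet_lt ?_ ?_) ?_ ?_ <;> fun_prop
  have hbound : ∀ w, |f w| ≤ (2 * (s + a)) ^ p := by
    intro w
    simp only [hf]
    split_ifs with h
    · rw [abs_of_nonneg (by positivity)]
      gcongr
      nlinarith [sq_nonneg (w.1 - c), sq_nonneg w.2]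
    · rw [abs_zero]; positivity
  have polar_sq : ∀ r θ : ℝ, (r * Real.cos θ) ^ 2 + (r * Real.sin θ) ^ 2 = r ^ 2 := by
    intro r θ
    linear_combination r ^ 2 * Real.sin_sq_add_cos_sq θ
  -- Polar coordinates around the centre of the disc produce the moment sum.
  have h1 : ∫ w, f w = Real.pi * s * charlierMoment a s p := by
    rw [integral_eq_polar_iterated (ρ := √s) hmeas hbound]
    swap
    · intro r θ hr
      simp only [hf]
      rw [polar_sq, if_neg]
      have := Real.sqrt_nonneg s
      rw [not_lt, ← hs2]
      gcongr
    set g : ℝ → ℝ := fun y => if y < s then Real.pi *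
      ∑ j ∈ Finset.range (p + 1), (p.choose j : ℝ) ^ 2 * a ^ (p - j) * y ^ j else 0 with hg
    have e : ∀ r ∈ Ioi (0 : ℝ), (∫ θ in (-Real.pi)..Real.pi,
        r * f (r * Real.cos θ, r * Real.sin θ)) = 2 * r * g (r ^ 2) := by
      intro r _
      simp only [hf, hg, polar_sq]
      split_ifs with h
      · have : ∀ θ : ℝ, (r * Real.cos θ + c) ^ 2 + (r * Real.sin θ) ^ 2
            = r ^ 2 + c ^ 2 + 2 * r * c * Real.cos θ := by
          intro θ
          linear_combination polar_sq r θ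
        simp only [this]
        rw [intervalIntegral.integral_const_mul, integral_trig_pow, hca]
        ring
      · simp
    rw [setIntegral_congr_fun measurableSet_Ioi e, integral_Ioi_mul_comp_sq]
    have e2 : g = (Iio s).indicator fun y => Real.pi *
          ∑ j ∈ Finset.range (p + 1), (p.choose j : ℝ) ^ 2 * a ^ (p - j) * y ^ j := by
      ext y
      simp [hg, Set.indicator_apply]
    rw [e2, setIntegral_indicator measurableSet_Iio, Ioi_inter_Iio, ← integral_Ioc_eq_integral_Ioo,
      ← intervalIntegral.integral_of_le hs.le, intervalIntegral.integral_const_mul,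
      intervalIntegral.integral_finsetSum, charlierMoment, mul_assoc]
    · congr 1
      rw [Finset.mul_sum]
      refine Finset.sum_congr rfl fun j _ => ?_
      rw [intervalIntegral.integral_const_mul, integral_pow]
      rw [zero_pow (Nat.succ_ne_zero j), sub_zero, pow_succ]
      ring
    · intro j _
      exact Continuous.intervalIntegrable (by fun_prop) _ _
  -- Polar coordinates around `(-c, 0)`: the integrand is `r ^ (2 p)` inside the disc, and the
  -- angles inside form an arc of half-length given by the arccosine. Then `z = r ^ 2`.
  have h2 : ∫ w, f w = ∫ z in Ioi (0 : ℝ), Real.arccos ((z + a - s) / (2 * √(a * z))) * z ^ p := by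
    rw [← integral_add_right_eq_self f ((-c, 0) : ℝ × ℝ)]
    rw [integral_eq_polar_iterated (ρ := c + √s) (M := (2 * (s + a)) ^ p) (by fun_prop)
      fun w => hbound _]
    swap
    · intro r θ hr
      have h0 := Real.sqrt_nonneg s
      simp only [hf, Prod.mk_add_mk, add_zero]
      rw [if_neg]
      rw [not_lt]
      have e : (r * Real.cos θ + -c) ^ 2 + (r * Real.sin θ) ^ 2
          = r ^ 2 + c ^ 2 - 2 * r * c * Real.cos θ := by
        linear_combination polar_sq r θ
      have e3 : r * c * Real.cos θ ≤ r * c := by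
        have : 0 ≤ r * c := by nlinarith
        nlinarith [Real.cos_le_one θ]
      rw [e, ← hs2]
      nlinarith
    rw [← integral_Ioi_mul_comp_sq
      fun z => Real.arccos ((z + a - s) / (2 * √(a * z))) * z ^ p]
    refine setIntegral_congr_fun measurableSet_Ioi fun r hr => ?_
    have hr : 0 < r := hr
    have hsqrt : √(a * r ^ 2) = c * r := by
      rw [Real.sqrt_mul ha.le, Real.sqrt_sq hr.le]
    have e : ∀ θ : ℝ, r * f ((r * Real.cos θ, r * Real.sin θ) + (-c, 0))
        = {θ | (r ^ 2 + a - s) / (2 * (c * r)) < Real.cos θ}.indicator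
            (fun _ => r * (r ^ 2) ^ p) θ := by
      intro θ
      have e4 : (r * Real.cos θ + -c) ^ 2 + (r * Real.sin θ) ^ 2
          = r ^ 2 + a - 2 * (c * r) * Real.cos θ := by
        linear_combination polar_sq r θ + hca
      simp only [hf, Prod.mk_add_mk, add_zero, Set.indicator_apply, Set.mem_ofPred_eq]
      rw [e4, neg_add_cancel_right, polar_sq, mul_ite, mul_zero]
      refine if_congr ?_ rfl rfl
      rw [div_lt_iff₀ (by positivity)]
      constructor <;> intro h <;> linarith
    change _ = 2 * r * (Real.arccos ((r ^ 2 + a - s) / (2 * √(a * r ^ 2))) * (r ^ 2) ^ p)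
    rw [hsqrt, intervalIntegral.integral_of_le (by linarith [Real.pi_pos]), integral_Ioc_eq_integral_Ioo]
    simp only [e]
    have hset : MeasurableSet {θ | (r ^ 2 + a - s) / (2 * (c * r)) < Real.cos θ} :=
      measurableSet_lt measurable_const Real.measurable_cos
    have h0 := Real.arccos_nonneg ((r ^ 2 + a - s) / (2 * (c * r)))
    rw [setIntegral_indicator hset, setIntegral_const,
      show Ioo (-Real.pi) Real.pi ∩ {θ | (r ^ 2 + a - s) / (2 * (c * r)) < Real.cos θ} = _ from
        setOf_lt_cos _, Measure.real, Real.volume_Ioo, ENNReal.toReal_ofReal (by linarith),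
      smul_eq_mul]
    ring
  rw [← h2, h1]

end DiscIntegral

/-! ### The density and the end points of its support. -/

section LimitDensity

theorem integral_one_div_sqrt_one_sub_sq {c : ℝ} (h1 : -1 ≤ c) (h2 : c ≤ 1) :
    ∫ u in c..1, 1 / √(1 - u ^ 2) = Real.arccos c := by
  have hderiv : ∀ u ∈ Ioo c 1, HasDerivAt Real.arcsin (1 / √(1 - u ^ 2)) u := fun u hu =>
    Real.hasDerivAt_arcsin (by linarith [hu.1]) hu.2.ne
  rw [intervalIntegral.integral_eq_sub_of_hasDerivAt_of_le h2 Real.continuous_arcsin.continuousOn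
    hderiv, Real.arcsin_one, Real.arccos]
  rw [intervalIntegrable_iff_integrableOn_Ioc_of_le h2]
  exact intervalIntegral.integrableOn_deriv_of_nonneg Real.continuous_arcsin.continuousOn hderiv
    fun u _ => by positivity

/-- The quotient whose arccosine gives the density. -/
noncomputable def densityCos (a s z : ℝ) : ℝ := (z + a - s) / (2 * √(a * z))

variable {a s z : ℝ}

/-- Rests on the symmetry `(z + a - s)^2 - 4 a z = (z - (a + s))^2 - 4 a s`. -/
theorem sq_sub_le_iff (ha : 0 ≤ a) (hs : 0 ≤ s) :
    (z + a - s) ^ 2 ≤ 4 * (a * z) ↔ a + s - 2 * √(a * s) ≤ z ∧ z ≤ a + s + 2 * √(a * s) := by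
  have h := Real.sq_sqrt (mul_nonneg ha hs)
  have h0 := Real.sqrt_nonneg (a * s)
  have e : (z + a - s) ^ 2 ≤ 4 * (a * z) ↔ (z - (a + s)) ^ 2 ≤ (2 * √(a * s)) ^ 2 := by
    constructor <;> intro h' <;> nlinarith
  rw [e, sq_le_sq, abs_of_nonneg (by positivity : 0 ≤ 2 * √(a * s)), abs_le]
  constructor <;> rintro ⟨h1, h2⟩ <;> constructor <;> linarith

theorem left_eq_sq (ha : 0 ≤ a) (hs : 0 ≤ s) : a + s - 2 * √(a * s) = (√a - √s) ^ 2 := by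
  rw [Real.sqrt_mul ha, sub_sq, Real.sq_sqrt ha, Real.sq_sqrt hs]
  ring

theorem abs_densityCos_le_one (ha : 0 ≤ a) (hs : 0 ≤ s) (h1 : a + s - 2 * √(a * s) ≤ z)
    (h2 : z ≤ a + s + 2 * √(a * s)) : |densityCos a s z| ≤ 1 := by
  have h := (sq_sub_le_iff ha hs).2 ⟨h1, h2⟩
  have hle : |z + a - s| ≤ 2 * √(a * z) := by
    have := Real.abs_le_sqrt h
    rwa [Real.sqrt_mul (by norm_num), show √(4 : ℝ) = 2 by
      rw [show (4 : ℝ) = 2 ^ 2 by norm_num]; exact Real.sqrt_sq (by norm_num)] at this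
  rw [densityCos, abs_div, abs_of_nonneg (by positivity : 0 ≤ 2 * √(a * z))]
  exact div_le_one_of_le₀ hle (by positivity)

theorem two_mul_sqrt_le_abs (h : 4 * (a * z) ≤ (z + a - s) ^ 2) : 2 * √(a * z) ≤ |z + a - s| := by
  have := Real.sqrt_le_sqrt h
  rwa [Real.sqrt_sq_eq_abs, Real.sqrt_mul (by norm_num), show √(4 : ℝ) = 2 by
      rw [show (4 : ℝ) = 2 ^ 2 by norm_num]; exact Real.sqrt_sq (by norm_num)] at this

theorem densityCos_lt_one (ha : 0 < a) (hs : 0 < s) (hz : 0 < z) (h1 : a + s - 2 * √(a * s) < z)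
    (h2 : z < a + s + 2 * √(a * s)) : densityCos a s z < 1 := by
  have hpos : 0 < √(a * z) := Real.sqrt_pos.2 (mul_pos ha hz)
  rw [densityCos, div_lt_one (by positivity)]
  by_contra! hge
  have h3 := Real.sq_sqrt (mul_pos ha hz).le
  have h4 := Real.sq_sqrt (mul_pos ha hs).le
  have h5 : (2 * √(a * z)) ^ 2 ≤ (z + a - s) ^ 2 := by gcongr
  have h6 := mul_pos (sub_pos.2 h1) (sub_pos.2 h2)
  nlinarith

theorem densityCos_le_neg_one (ha : 0 < a) (has : a < s) (hz : 0 < z)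
    (h1 : z ≤ a + s - 2 * √(a * s)) : densityCos a s z ≤ -1 := by
  have hs : 0 < s := ha.trans has
  have hpos : 0 < √(a * z) := Real.sqrt_pos.2 (mul_pos ha hz)
  have h4 := Real.sq_sqrt (mul_pos ha hs).le
  -- This makes `z + a - s ≤ 2 a - 2 √(a s)` negative and fixes the sign of the quotient.
  have h5 : a < √(a * s) := Real.lt_sqrt_of_sq_lt (by nlinarith)
  have h6 := two_mul_sqrt_le_abs (a := a) (s := s) (z := z) (by nlinarith)
  rw [abs_of_neg (by linarith)] at h6
  rw [densityCos, div_le_iff₀ (by positivity)]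
  linarith

theorem one_le_densityCos_of_le (ha : 0 < a) (hs : 0 < s) (has : s ≤ a) (hz : 0 < z)
    (h1 : z ≤ a + s - 2 * √(a * s)) : 1 ≤ densityCos a s z := by
  have hpos : 0 < √(a * z) := Real.sqrt_pos.2 (mul_pos ha hz)
  have h4 := Real.sq_sqrt (mul_pos ha hs).le
  have h5 := Real.sqrt_nonneg (a * s)
  have h6 := two_mul_sqrt_le_abs (a := a) (s := s) (z := z) (by nlinarith)
  rw [abs_of_nonneg (by linarith)] at h6
  rwa [densityCos, one_le_div (by positivity)]

theorem one_le_densityCos_of_ge (ha : 0 < a) (hs : 0 < s)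
    (h1 : a + s + 2 * √(a * s) ≤ z) : 1 ≤ densityCos a s z := by
  have h4 := Real.sq_sqrt (mul_pos ha hs).le
  have h5 := Real.sqrt_nonneg (a * s)
  have hz : 0 < z := by linarith
  have hpos : 0 < √(a * z) := Real.sqrt_pos.2 (mul_pos ha hz)
  have h6 := two_mul_sqrt_le_abs (a := a) (s := s) (z := z) (by nlinarith)
  rw [abs_of_nonneg (by linarith)] at h6
  rwa [densityCos, one_le_div (by positivity)]

theorem charlierMoment_zero (a s : ℝ) : charlierMoment a s 0 = 1 := by
  simp [charlierMoment]

variable {q t y : ℝ}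

/-- Separates the shift by `(1 - q) t` from the arc for `s = q t`. -/
theorem arcLeft_eq : arcLeft a q t = a + q * t - 2 * √(a * (q * t)) + (1 - q) * t := by
  rw [arcLeft, mul_assoc]; ring

theorem betaEnd_eq : betaEnd a q t = a + q * t + 2 * √(a * (q * t)) + (1 - q) * t := by
  rw [betaEnd, mul_assoc]; ring

theorem le_arcLeft (ha : 0 ≤ a) (hs : 0 ≤ q * t) : (1 - q) * t ≤ arcLeft a q t := by
  rw [arcLeft_eq, left_eq_sq ha hs]
  nlinarith [sq_nonneg (√a - √(q * t))]

theorem le_alphaEnd (ha : 0 ≤ a) (hs : 0 ≤ q * t) : (1 - q) * t ≤ alphaEnd a q t := by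
  rw [alphaEnd]
  split_ifs
  · exact le_arcLeft ha hs
  · rfl

theorem alphaEnd_lt_betaEnd (ha : 0 < a) (hs : 0 < q * t) : alphaEnd a q t < betaEnd a q t := by
  have h : 0 < √(a * (q * t)) := Real.sqrt_pos.2 (mul_pos ha hs)
  rw [alphaEnd, betaEnd_eq]
  split_ifs
  · rw [arcLeft_eq]; linarith
  · linarith

theorem lt_alphaEnd_iff (ha : 0 < a) (hs : 0 < q * t) :
    (1 - q) * t < alphaEnd a q t ↔ q * t < a := by
  rw [alphaEnd]
  split_ifs with h
  · rw [arcLeft_eq, left_eq_sq ha.le hs.le]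
    constructor
    · intro h1
      refine lt_of_le_of_ne h fun h2 => ?_
      rw [h2] at h1
      simp at h1
    · intro h1
      have := Real.sqrt_lt_sqrt hs.le h1
      have : 0 < (√a - √(q * t)) ^ 2 := by
        have := sub_pos.2 this
        positivity
      linarith
  · exact ⟨fun h1 => absurd h1 (lt_irrefl _), fun h1 => absurd h1.le h⟩

theorem zeroDensity_eq_of_mem_arc (ha : 0 < a) (hs : 0 < q * t)
    (hn : ¬(a < q * t ∧ y ≤ arcLeft a q t)) (h1 : arcLeft a q t ≤ y) (h2 : y ≤ betaEnd a q t) :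
    zeroDensity a q t y
      = 1 / (Real.pi * (q * t)) * Real.arccos (densityCos a (q * t) (y - (1 - q) * t)) := by
  rw [arcLeft_eq] at h1
  rw [betaEnd_eq] at h2
  have h := abs_le.1 (abs_densityCos_le_one ha.le hs.le (z := y - (1 - q) * t) (by linarith)
    (by linarith))
  rw [zeroDensity, if_neg hn, ← integral_one_div_sqrt_one_sub_sq h.1 h.2, densityCos, mul_assoc,
    show y - (1 - q) * t + a - q * t = y + a - t by ring]

/-- On the plateau the quotient is at most `-1` and `arccos` is `π`, so one formula covers both
branches. The left end point is excluded: for `a < q t` the quotient there has denominator zero. -/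
theorem zeroDensity_eq (ha : 0 < a) (hs : 0 < q * t) (h1 : alphaEnd a q t < y)
    (h2 : y ≤ betaEnd a q t) : zeroDensity a q t y
      = 1 / (Real.pi * (q * t)) * Real.arccos (densityCos a (q * t) (y - (1 - q) * t)) := by
  by_cases h : a < q * t ∧ y ≤ arcLeft a q t
  · rw [alphaEnd, if_neg (not_le.2 h.1)] at h1
    have h3 := h.2
    rw [arcLeft_eq] at h3
    rw [zeroDensity, if_pos h, Real.arccos_of_le_neg_one
      (densityCos_le_neg_one ha h.1 (by linarith) (by linarith))]
    field_simp
  · refine zeroDensity_eq_of_mem_arc ha hs h ?_ h2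
    by_cases h3 : a < q * t
    · exact le_of_not_ge fun h4 => h ⟨h3, h4⟩
    · rw [alphaEnd, if_pos (not_lt.1 h3)] at h1
      exact h1.le

theorem zeroDensity_nonneg (ha : 0 < a) (hs : 0 < q * t)
    (hy : y ∈ Icc (alphaEnd a q t) (betaEnd a q t)) : 0 ≤ zeroDensity a q t y := by
  by_cases h : a < q * t ∧ y ≤ arcLeft a q t
  · rw [zeroDensity, if_pos h]
    positivity
  · rw [zeroDensity_eq_of_mem_arc ha hs h ?_ hy.2]
    · exact mul_nonneg (by positivity) (Real.arccos_nonneg _)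
    · by_cases h3 : a < q * t
      · exact le_of_not_ge fun h4 => h ⟨h3, h4⟩
      · have := hy.1
        rwa [alphaEnd, if_pos (not_lt.1 h3)] at this

theorem zeroDensity_pos (ha : 0 < a) (hs : 0 < q * t)
    (hy : y ∈ Ioo (alphaEnd a q t) (betaEnd a q t)) : 0 < zeroDensity a q t y := by
  have hpos := (le_alphaEnd ha.le hs.le).trans_lt hy.1
  by_cases h : a < q * t ∧ y ≤ arcLeft a q t
  · rw [zeroDensity, if_pos h]
    positivity
  · rw [zeroDensity_eq ha hs hy.1 hy.2.le]
    refine mul_pos (by positivity) (Real.arccos_pos.2 (densityCos_lt_one ha hs (by linarith) ?_ ?_))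
    · have : arcLeft a q t < y := by
        by_cases h3 : a < q * t
        · exact lt_of_not_ge fun h4 => h ⟨h3, h4⟩
        · have := hy.1
          rwa [alphaEnd, if_pos (not_lt.1 h3)] at this
      rw [arcLeft_eq] at this
      linarith
    · have := hy.2
      rw [betaEnd_eq] at this
      linarith

theorem measurable_densityCos (a s : ℝ) : Measurable (densityCos a s) := by
  unfold densityCos
  fun_prop

theorem intervalIntegrable_zeroDensity (ha : 0 < a) (hs : 0 < q * t) :
    IntervalIntegrable (zeroDensity a q t) volume (alphaEnd a q t) (betaEnd a q t) := by
  rw [intervalIntegrable_iff_integrableOn_Ioc_of_le (alphaEnd_lt_betaEnd ha hs).le]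
  have h : IntegrableOn (fun y => 1 / (Real.pi * (q * t))
      * Real.arccos (densityCos a (q * t) (y - (1 - q) * t)))
      (Ioc (alphaEnd a q t) (betaEnd a q t)) := by
    have hm : Measurable fun y => 1 / (Real.pi * (q * t))
        * Real.arccos (densityCos a (q * t) (y - (1 - q) * t)) :=
      (Real.measurable_arccos.comp
        ((measurable_densityCos a (q * t)).comp (measurable_id.sub_const _))).const_mul _
    refine Measure.integrableOn_of_bounded (M := 1 / (Real.pi * (q * t)) * Real.pi) (by simp)
      hm.aestronglyMeasurable (Eventually.of_forall fun y => ?_)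
    rw [Real.norm_of_nonneg (mul_nonneg (by positivity) (Real.arccos_nonneg _))]
    exact mul_le_mul_of_nonneg_left (Real.arccos_le_pi _) (by positivity)
  exact h.congr_fun (fun y hy => (zeroDensity_eq ha hs hy.1 hy.2).symm) measurableSet_Ioc

theorem integral_zeroDensity_mul_pow (ha : 0 < a) (hs : 0 < q * t) (p : ℕ) :
    ∫ y in (alphaEnd a q t)..(betaEnd a q t), zeroDensity a q t y * (y - (1 - q) * t) ^ p
      = charlierMoment a (q * t) p := by
  have hlt := alphaEnd_lt_betaEnd ha hs
  have h0 := le_alphaEnd ha.le hs.le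
  set g : ℝ → ℝ := fun z => Real.arccos (densityCos a (q * t) z) * z ^ p with hg
  have e1 : ∫ y in (alphaEnd a q t)..(betaEnd a q t), zeroDensity a q t y * (y - (1 - q) * t) ^ p
      = ∫ y in (alphaEnd a q t)..(betaEnd a q t),
          1 / (Real.pi * (q * t)) * g (y - (1 - q) * t) := by
    rw [intervalIntegral.integral_of_le hlt.le, intervalIntegral.integral_of_le hlt.le]
    refine setIntegral_congr_fun measurableSet_Ioc fun y hy => ?_
    simp only [hg]
    rw [zeroDensity_eq ha hs hy.1 hy.2, mul_assoc]
  -- Off the support the quotient is at least `1` and `arccos` vanishes. Positive points to the left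
  -- of the support exist only if `q t < a`.
  have e2 : ∫ z in Ioi (0 : ℝ), g z
      = ∫ z in Ioc (alphaEnd a q t - (1 - q) * t) (betaEnd a q t - (1 - q) * t), g z := by
    refine setIntegral_eq_of_subset_of_forall_sdiff_eq_zero measurableSet_Ioi
      (fun z hz => ?_) fun z hz => ?_
    · have := hz.1
      rw [mem_Ioi]
      linarith
    · have hz0 : 0 < z := hz.1
      have h1 : 1 ≤ densityCos a (q * t) z := by
        rcases lt_or_ge (alphaEnd a q t - (1 - q) * t) z with h | h
        · refine one_le_densityCos_of_ge ha hs ?_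
          have : betaEnd a q t - (1 - q) * t < z := lt_of_not_ge fun h' => hz.2 ⟨h, h'⟩
          rw [betaEnd_eq] at this
          linarith
        · by_cases has : q * t ≤ a
          · rw [alphaEnd, if_pos has, arcLeft_eq] at h
            exact one_le_densityCos_of_le ha hs has hz0 (by linarith)
          · rw [alphaEnd, if_neg has] at h
            linarith
      simp only [hg]
      rw [Real.arccos_of_one_le h1, zero_mul]
  have e3 := integral_arccos_mul_pow ha hs p
  change ∫ z in Ioi (0 : ℝ), g z = _ at e3
  rw [e1, intervalIntegral.integral_const_mul,
    intervalIntegral.integral_comp_sub_right (fun z => g z),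
    intervalIntegral.integral_of_le (by linarith), ← e2, e3]
  rw [← mul_assoc, one_div, inv_mul_cancel₀ (mul_ne_zero Real.pi_ne_zero hs.ne'), one_mul]

theorem integral_zeroDensity (ha : 0 < a) (hs : 0 < q * t) :
    ∫ y in (alphaEnd a q t)..(betaEnd a q t), zeroDensity a q t y = 1 := by
  have := integral_zeroDensity_mul_pow ha hs 0
  simpa [charlierMoment_zero] using this

end LimitDensity

/-! ### Convergence of averages over zeros. -/

section Averages

open Polynomial

variable {α : Type*} {F : Filter α}

theorem tendsto_of_forall_eps {A B δ : α → ℝ} {L : ℝ} (hB : Tendsto B F (𝓝 L))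
    (hδ : Tendsto δ F (𝓝 0))
    (h : ∀ ε > 0, ∃ C : ℝ, ∀ᶠ i in F, |A i - B i| ≤ ε + C * δ i) : Tendsto A F (𝓝 L) := by
  have h0 : Tendsto (fun i => A i - B i) F (𝓝 0) := by
    rw [Metric.tendsto_nhds]
    intro ε hε
    obtain ⟨C, hC⟩ := h (ε / 2) (by positivity)
    have h1 : Tendsto (fun i => ε / 2 + C * δ i) F (𝓝 (ε / 2)) := by
      simpa using (hδ.const_mul C).const_add (ε / 2)
    filter_upwards [hC, h1.eventually (gt_mem_nhds (half_lt_self hε))] with i h2 h3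
    rw [Real.dist_eq, sub_zero]
    linarith
  simpa using h0.add hB

/-- Uniform continuity handles nearby `y`, the bound `2 M` distant ones. As `y` is unrestricted,
control of the mean displacement suffices later, even if single zeros escape. -/
theorem exists_abs_sub_le_add_mul {f : ℝ → ℝ} (hf : Continuous f) {M : ℝ} (hM : ∀ x, |f x| ≤ M)
    (K : ℝ) {ε : ℝ} (hε : 0 < ε) :
    ∃ C, 0 ≤ C ∧ ∀ z ∈ Icc 0 K, ∀ y, |f y - f z| ≤ ε + C * |y - z| := by
  have hM0 : 0 ≤ M := (abs_nonneg _).trans (hM 0)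
  have huc := (isCompact_Icc (a := (-1 : ℝ)) (b := K + 1)).uniformContinuousOn_of_continuous
    hf.continuousOn
  obtain ⟨δ, hδ, h⟩ := Metric.uniformContinuousOn_iff.1 huc ε hε
  refine ⟨2 * M / min δ 1, by positivity, fun z hz y => ?_⟩
  rcases lt_or_ge |y - z| (min δ 1) with hlt | hge
  · have h1 := abs_lt.1 (hlt.trans_le (min_le_right _ _))
    have := h y ⟨by linarith [hz.1], by linarith [hz.2]⟩ z ⟨by linarith [hz.1], by linarith [hz.2]⟩
      (by rw [Real.dist_eq]; exact hlt.trans_le (min_le_left _ _))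
    rw [Real.dist_eq] at this
    have h2 : 0 ≤ 2 * M / min δ 1 * |y - z| := by positivity
    linarith
  · have h1 : 2 * M ≤ 2 * M / min δ 1 * |y - z| := by
      rw [div_mul_eq_mul_div, le_div_iff₀ (by positivity)]
      gcongr
    have h2 := (abs_sub (f y) (f z)).trans (add_le_add (hM y) (hM z))
    linarith

/-- Riemann sums over the points `i / ν`. -/
theorem tendsto_riemann_sum {f : ℝ → ℝ} (hf : Continuous f) {M : ℝ} (hM : ∀ x, |f x| ≤ M)
    {k : α → ℕ} {ν : α → ℝ} {c : ℝ} (hc : 0 ≤ c) (hν : Tendsto ν F atTop)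
    (hk : Tendsto (fun i => (k i : ℝ) / ν i) F (𝓝 c)) :
    Tendsto (fun i => 1 / ν i * ∑ j ∈ Finset.range (k i), f (j / ν i)) F
      (𝓝 (∫ x in (0 : ℝ)..c, f x)) := by
  have hprim : Tendsto (fun i => ∫ x in (0 : ℝ)..(k i / ν i), f x) F
      (𝓝 (∫ x in (0 : ℝ)..c, f x)) :=
    ((intervalIntegral.continuous_primitive (fun a b => hf.intervalIntegrable a b) 0).tendsto
      c).comp hk
  refine tendsto_of_forall_eps hprim (hν.const_div_atTop 1) fun ε hε => ?_
  obtain ⟨C, hC0, hC⟩ := exists_abs_sub_le_add_mul hf hM (c + 1)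
    (ε := ε / (c + 1)) (by positivity)
  refine ⟨(c + 1) * C, ?_⟩
  filter_upwards [hν.eventually_gt_atTop 0, hk.eventually (gt_mem_nhds (lt_add_one c))]
    with i hνi hki
  have hsum := intervalIntegral.sum_integral_adjacent_intervals (μ := volume) (f := f)
    (a := fun j : ℕ => (j : ℝ) / ν i) (n := k i) fun j _ => hf.intervalIntegrable _ _
  simp only [Nat.cast_zero, zero_div] at hsum
  rw [← hsum, Finset.mul_sum, ← Finset.sum_sub_distrib]
  have hterm : ∀ j ∈ Finset.range (k i), |1 / ν i * f (j / ν i)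
      - ∫ x in ((j : ℝ) / ν i)..(((j + 1 : ℕ) : ℝ) / ν i), f x|
      ≤ (ε / (c + 1) + C * (1 / ν i)) * (1 / ν i) := by
    intro j hj
    have hlen : ((j + 1 : ℕ) : ℝ) / ν i - (j : ℝ) / ν i = 1 / ν i := by
      push_cast; ring
    have hpos : 0 < 1 / ν i := by positivity
    have e : 1 / ν i * f (j / ν i)
        = ∫ x in ((j : ℝ) / ν i)..(((j + 1 : ℕ) : ℝ) / ν i), f (j / ν i) := by
      rw [intervalIntegral.integral_const, hlen, smul_eq_mul]
    rw [e, abs_sub_comm, ← intervalIntegral.integral_sub (hf.intervalIntegrable _ _)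
      (by simp), ← Real.norm_eq_abs]
    refine (intervalIntegral.norm_integral_le_of_norm_le_const
      (C := ε / (c + 1) + C * (1 / ν i)) fun x hx => ?_).trans (le_of_eq ?_)
    · rw [uIoc_of_le (by linarith)] at hx
      have hz : (j : ℝ) / ν i ∈ Icc 0 (c + 1) := by
        refine ⟨by positivity, le_trans ?_ hki.le⟩
        have : (j : ℝ) ≤ k i := by exact_mod_cast (Finset.mem_range.1 hj).le
        gcongr
      refine (hC _ hz x).trans ?_
      have : |x - j / ν i| ≤ 1 / ν i := by
        rw [abs_of_nonneg (by linarith [hx.1])]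
        linarith [hx.2]
      gcongr
    · rw [hlen, abs_of_pos hpos]
  refine (Finset.abs_sum_le_sum_abs _ _).trans ((Finset.sum_le_sum hterm).trans ?_)
  rw [Finset.sum_const, Finset.card_range, nsmul_eq_mul]
  have e2 : (k i : ℝ) * ((ε / (c + 1) + C * (1 / ν i)) * (1 / ν i))
      = (k i / ν i) * (ε / (c + 1) + C * (1 / ν i)) := by ring
  rw [e2]
  calc (k i / ν i) * (ε / (c + 1) + C * (1 / ν i))
      ≤ (c + 1) * (ε / (c + 1) + C * (1 / ν i)) := by gcongr
    _ = ε + (c + 1) * C * (1 / ν i) := by field_simp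

variable {n k : α → ℕ} {ν : α → ℝ} {a q t : ℝ} {x y : α → ℕ → ℝ}

theorem intervalIntegrable_zeroDensity_mul (ha : 0 < a) (hs : 0 < q * t) {f : ℝ → ℝ}
    (hf : Continuous f) : IntervalIntegrable (fun y => zeroDensity a q t y * f y) volume
      (alphaEnd a q t) (betaEnd a q t) :=
  (intervalIntegrable_zeroDensity ha hs).mul_continuousOn hf.continuousOn

theorem tendsto_charlier_polynomial_average (ha : 0 < a) (hs : 0 < q * t) (hν : Tendsto ν F atTop)
    (hn : Tendsto (fun i => (n i : ℝ) / ν i) F (𝓝 (q * t)))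
    (hx : ∀ᶠ i in F, SpacedRoots (umbral ((X - C (ν i * a)) ^ n i)) (n i) (x i)) (P : ℝ[X]) :
    Tendsto (fun i => 1 / (n i : ℝ) * ∑ j ∈ Finset.range (n i), P.eval (x i j / ν i)) F
      (𝓝 (∫ y in (alphaEnd a q t)..(betaEnd a q t),
        zeroDensity a q t y * P.eval (y - (1 - q) * t))) := by
  induction P using Polynomial.induction_on' with
  | add P Q hP hQ =>
    have h := hP.add hQ
    rw [← intervalIntegral.integral_add (intervalIntegrable_zeroDensity_mul ha hs (by fun_prop))
      (intervalIntegrable_zeroDensity_mul ha hs (by fun_prop))] at h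
    simp only [eval_add, Finset.sum_add_distrib, mul_add]
    exact h
  | monomial p c =>
    have h := (tendsto_charlier_moment ha hs hν hn hx p).const_mul c
    rw [← integral_zeroDensity_mul_pow ha hs, ← intervalIntegral.integral_const_mul] at h
    have e : ∀ y, zeroDensity a q t y * (monomial p c).eval (y - (1 - q) * t)
        = c * (zeroDensity a q t y * (y - (1 - q) * t) ^ p) := fun y => by
      rw [eval_monomial]; ring
    simp only [e]
    refine h.congr fun i => ?_
    simp only [eval_monomial, ← Finset.mul_sum]
    ring

theorem abs_average_le {m : ℕ} {g : ℕ → ℝ} {ε : ℝ} (hε : 0 ≤ ε) (h : ∀ j < m, |g j| ≤ ε) :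
    |1 / (m : ℝ) * ∑ j ∈ Finset.range m, g j| ≤ ε := by
  rw [abs_mul, abs_of_nonneg (by positivity)]
  have h1 : |∑ j ∈ Finset.range m, g j| ≤ m * ε := by
    refine (Finset.abs_sum_le_sum_abs _ _).trans
      ((Finset.sum_le_sum fun j hj => h j (Finset.mem_range.1 hj)).trans (le_of_eq ?_))
    rw [Finset.sum_const, Finset.card_range, nsmul_eq_mul]
  rcases Nat.eq_zero_or_pos m with rfl | hm
  · simpa using hε
  · rw [one_div_mul_eq_div, div_le_iff₀ (by positivity)]
    linarith

/-- The limit distribution of the zeros of the Charlier polynomials, shifted by `(1 - q) t`. -/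
theorem tendsto_charlier_average (ha : 0 < a) (hs : 0 < q * t) (hν : Tendsto ν F atTop)
    (hn : Tendsto (fun i => (n i : ℝ) / ν i) F (𝓝 (q * t)))
    (hx : ∀ᶠ i in F, SpacedRoots (umbral ((X - C (ν i * a)) ^ n i)) (n i) (x i))
    {f : ℝ → ℝ} (hf : Continuous f) :
    Tendsto (fun i => 1 / (n i : ℝ) * ∑ j ∈ Finset.range (n i), f (x i j / ν i + (1 - q) * t)) F
      (𝓝 (∫ y in (alphaEnd a q t)..(betaEnd a q t), zeroDensity a q t y * f y)) := by
  have hlt := alphaEnd_lt_betaEnd ha hs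
  have h0 := le_alphaEnd ha.le hs.le
  -- `[0, K]` contains both the scaled zeros and the unshifted support.
  set K := max ((1 + a) * (1 + (q * t + 1))) (betaEnd a q t - (1 - q) * t) with hK
  rw [Metric.tendsto_nhds]
  intro ε hε
  obtain ⟨P, hP⟩ := exists_polynomial_near_of_continuousOn 0 K (fun z => f (z + (1 - q) * t))
    (by fun_prop) (ε / 4) (by positivity)
  have hlim := tendsto_charlier_polynomial_average ha hs hν hn hx P
  have hint : |(∫ y in (alphaEnd a q t)..(betaEnd a q t),
        zeroDensity a q t y * P.eval (y - (1 - q) * t))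
      - ∫ y in (alphaEnd a q t)..(betaEnd a q t), zeroDensity a q t y * f y| ≤ ε / 4 := by
    rw [← intervalIntegral.integral_sub
      (intervalIntegrable_zeroDensity_mul ha hs (by fun_prop : Continuous fun y : ℝ =>
        P.eval (y - (1 - q) * t))) (intervalIntegrable_zeroDensity_mul ha hs hf)]
    have h1 : ∫ y in (alphaEnd a q t)..(betaEnd a q t), zeroDensity a q t y * (ε / 4)
        = ε / 4 := by
      rw [intervalIntegral.integral_mul_const, integral_zeroDensity ha hs, one_mul]
    rw [← Real.norm_eq_abs, ← h1]
    refine intervalIntegral.norm_integral_le_of_norm_le hlt.le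
      (Eventually.of_forall fun y hy => ?_)
      ((intervalIntegrable_zeroDensity ha hs).mul_const _)
    have h2 := zeroDensity_nonneg ha hs ⟨hy.1.le, hy.2⟩
    rw [← mul_sub, norm_mul, Real.norm_of_nonneg h2]
    refine mul_le_mul_of_nonneg_left ?_ h2
    have h3 := hP (y - (1 - q) * t) ⟨by linarith [hy.1], le_max_of_le_right (by linarith [hy.2])⟩
    rw [sub_add_cancel] at h3
    exact h3.le
  filter_upwards [Metric.tendsto_nhds.1 hlim (ε / 4) (by positivity), hx,
    hν.eventually_gt_atTop 0, hn.eventually (gt_mem_nhds (lt_add_one (q * t)))] with i h1 hxi hνi hni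
  have h2 : |1 / (n i : ℝ) * ∑ j ∈ Finset.range (n i),
      (P.eval (x i j / ν i) - f (x i j / ν i + (1 - q) * t))| ≤ ε / 4 := by
    refine abs_average_le (by positivity) fun j hj => ?_
    refine (hP (x i j / ν i) ⟨?_, ?_⟩).le
    · exact div_nonneg (hxi.pos j hj).le hνi.le
    · exact le_max_of_le_left (charlier_root_div_le ha hνi hni.le hxi hj)
  rw [Finset.sum_sub_distrib, mul_sub] at h2
  rw [Real.dist_eq] at h1 ⊢
  have h3 := abs_lt.1 h1
  have h4 := abs_le.1 h2
  have h5 := abs_le.1 hint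
  rw [abs_lt]
  constructor <;> linarith [h3.1, h3.2, h4.1, h4.2, h5.1, h5.2]

/-- The limit distribution of zeros that lie beyond `0, 1, …, k - 1` and the shifted Charlier zeros
`x j + k`, by a total amount `O(k)`. -/
theorem tendsto_average_of_dominates (ha : 0 < a) (hq : 0 < q) (hq1 : q < 1) (ht : 0 < t)
    (hν : Tendsto ν F atTop) (hn : Tendsto (fun i => (n i : ℝ) / ν i) F (𝓝 (q * t)))
    (hk : Tendsto (fun i => (k i : ℝ) / ν i) F (𝓝 ((1 - q) * t)))
    (hx : ∀ᶠ i in F, SpacedRoots (umbral ((X - C (ν i * a)) ^ n i)) (n i) (x i))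
    (hy1 : ∀ᶠ i in F, ∀ j < k i, (j : ℝ) ≤ y i j)
    (hy2 : ∀ᶠ i in F, ∀ j < n i, x i j + k i ≤ y i (k i + j)) {A : ℝ} (hA : 0 ≤ A)
    (hy3 : ∀ᶠ i in F, ∑ j ∈ Finset.range (k i + n i), y i j
      ≤ ∑ j ∈ Finset.range (k i), (j : ℝ) + ∑ j ∈ Finset.range (n i), (x i j + k i) + A * k i)
    {f : ℝ → ℝ} (hf : Continuous f) {M : ℝ} (hM : ∀ x, |f x| ≤ M) :
    Tendsto (fun i => 1 / ((k i + n i : ℕ) : ℝ) *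
        ∑ j ∈ Finset.range (k i + n i), f (y i j / ν i)) F
      (𝓝 (1 / t * (∫ x in (0 : ℝ)..((1 - q) * t), f x) +
        q * ∫ y in (alphaEnd a q t)..(betaEnd a q t), zeroDensity a q t y * f y)) := by
  have hs : 0 < q * t := mul_pos hq ht
  have hτ : 0 < (1 - q) * t := mul_pos (sub_pos.2 hq1) ht
  have hd : Tendsto (fun i => ((k i + n i : ℕ) : ℝ) / ν i) F (𝓝 t) := by
    have := hk.add hn
    rw [show (1 - q) * t + q * t = t by ring] at this
    refine this.congr fun i => ?_
    push_cast
    ring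
  -- The average over the reference points, with `k i / ν i` replaced by its limit.
  set B : α → ℝ := fun i => 1 / ((k i + n i : ℕ) : ℝ) * (∑ j ∈ Finset.range (k i), f (j / ν i)
    + ∑ j ∈ Finset.range (n i), f (x i j / ν i + (1 - q) * t)) with hB
  have hBlim : Tendsto B F (𝓝 (1 / t * (∫ x in (0 : ℝ)..((1 - q) * t), f x) +
        q * ∫ y in (alphaEnd a q t)..(betaEnd a q t), zeroDensity a q t y * f y)) := by
    have h1 := (hd.inv₀ ht.ne').mul (tendsto_riemann_sum hf hM hτ.le hν hk)
    have h2 := (hn.div hd ht.ne').mul (tendsto_charlier_average ha hs hν hn hx hf)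
    rw [mul_div_cancel_right₀ _ ht.ne'] at h2
    rw [one_div]
    refine (h1.add h2).congr' ?_
    filter_upwards [hν.eventually_gt_atTop 0, hn.eventually (lt_mem_nhds hs),
      hd.eventually (lt_mem_nhds ht)] with i h3 h4 h5
    have h6 : (n i : ℝ) ≠ 0 := by
      intro h; rw [h, zero_div] at h4; exact h4.false
    have h7 : ((k i + n i : ℕ) : ℝ) ≠ 0 := by
      intro h; rw [h, zero_div] at h5; exact h5.false
    simp only [hB, Pi.div_apply]
    field_simp
  -- Mean displacement plus the error of that replacement.
  have hδ : Tendsto (fun i => A / ν i + |(k i : ℝ) / ν i - (1 - q) * t|) F (𝓝 0) := by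
    have h1 : Tendsto (fun i => |(k i : ℝ) / ν i - (1 - q) * t|) F (𝓝 0) := by
      simpa using (hk.sub_const ((1 - q) * t)).abs
    simpa using (hν.const_div_atTop A).add h1
  refine tendsto_of_forall_eps hBlim hδ fun ε hε => ?_
  set K := t + 1 + ((1 + a) * (1 + (q * t + 1)) + (1 - q) * t) with hK
  have hK1 : 0 ≤ (1 + a) * (1 + (q * t + 1)) + (1 - q) * t := by positivity
  obtain ⟨C, hC0, hC⟩ := exists_abs_sub_le_add_mul hf hM K hε
  refine ⟨C, ?_⟩
  filter_upwards [hx, hy1, hy2, hy3, hν.eventually_gt_atTop 0,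
    hd.eventually (gt_mem_nhds (lt_add_one t)), hn.eventually (gt_mem_nhds (lt_add_one (q * t))),
    hd.eventually (lt_mem_nhds ht)] with i hxi h1 h2 h3 hνi hdi hni hdi0
  have hd0 : 0 < ((k i + n i : ℕ) : ℝ) := by
    have := mul_pos hdi0 hνi
    rwa [div_mul_cancel₀ _ hνi.ne'] at this
  have hkν : (k i : ℝ) / ν i ≤ t + 1 := by
    refine le_trans ?_ hdi.le
    gcongr
    omega
  have e : 1 / ((k i + n i : ℕ) : ℝ) * ∑ j ∈ Finset.range (k i + n i), f (y i j / ν i) - B i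
      = 1 / ((k i + n i : ℕ) : ℝ) * (∑ j ∈ Finset.range (k i), (f (y i j / ν i) - f (j / ν i))
        + ∑ j ∈ Finset.range (n i),
          (f (y i (k i + j) / ν i) - f (x i j / ν i + (1 - q) * t))) := by
    simp only [hB]
    rw [Finset.sum_range_add, Finset.sum_sub_distrib, Finset.sum_sub_distrib]
    ring
  have hb1 : |∑ j ∈ Finset.range (k i), (f (y i j / ν i) - f (j / ν i))|
      ≤ ∑ j ∈ Finset.range (k i), (ε + C * ((y i j - j) / ν i)) := by
    refine (Finset.abs_sum_le_sum_abs _ _).trans (Finset.sum_le_sum fun j hj => ?_)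
    have hj := Finset.mem_range.1 hj
    have hjk : (j : ℝ) / ν i ≤ k i / ν i := by gcongr
    refine (hC (j / ν i) ⟨by positivity, by linarith⟩ _).trans (le_of_eq ?_)
    rw [← sub_div, abs_of_nonneg (div_nonneg (sub_nonneg.2 (h1 j hj)) hνi.le)]
  have hb2 : |∑ j ∈ Finset.range (n i), (f (y i (k i + j) / ν i) - f (x i j / ν i + (1 - q) * t))|
      ≤ ∑ j ∈ Finset.range (n i), (ε + C * ((y i (k i + j) - (x i j + k i)) / ν i
        + |(k i : ℝ) / ν i - (1 - q) * t|)) := by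
    refine (Finset.abs_sum_le_sum_abs _ _).trans (Finset.sum_le_sum fun j hj => ?_)
    have hj := Finset.mem_range.1 hj
    have hx0 := div_nonneg (hxi.pos j hj).le hνi.le
    have hx1 := charlier_root_div_le ha hνi hni.le hxi hj
    refine (hC (x i j / ν i + (1 - q) * t) ⟨by linarith, by linarith⟩ _).trans ?_
    gcongr
    have e4 : y i (k i + j) / ν i - (x i j / ν i + (1 - q) * t)
        = (y i (k i + j) - (x i j + k i)) / ν i + ((k i : ℝ) / ν i - (1 - q) * t) := by
      field_simp
      ring
    rw [e4]
    refine (abs_add_le _ _).trans ?_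
    rw [abs_of_nonneg (div_nonneg (sub_nonneg.2 (h2 j hj)) hνi.le)]
  have hk0 : (k i : ℝ) ≤ ((k i + n i : ℕ) : ℝ) := by exact_mod_cast Nat.le_add_right _ _
  have hn0 : (n i : ℝ) ≤ ((k i + n i : ℕ) : ℝ) := by exact_mod_cast Nat.le_add_left _ _
  -- All displacements are nonnegative, so their absolute values add up to a difference of totals.
  have htot : ∑ j ∈ Finset.range (k i), (y i j - j)
      + ∑ j ∈ Finset.range (n i), (y i (k i + j) - (x i j + k i)) ≤ A * k i := by
    rw [Finset.sum_range_add] at h3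
    rw [Finset.sum_sub_distrib, Finset.sum_sub_distrib]
    linarith
  set D := |(k i : ℝ) / ν i - (1 - q) * t| with hD
  have hD0 : 0 ≤ D := abs_nonneg _
  rw [e, abs_mul, abs_of_nonneg (by positivity), one_div_mul_eq_div, div_le_iff₀ hd0]
  refine (abs_add_le _ _).trans ((add_le_add hb1 hb2).trans ?_)
  simp only [Finset.sum_add_distrib, ← Finset.mul_sum, ← Finset.sum_div, Finset.sum_const,
    Finset.card_range, nsmul_eq_mul]
  have h8 : (∑ j ∈ Finset.range (k i), (y i j - j)) / ν i
      + (∑ j ∈ Finset.range (n i), (y i (k i + j) - (x i j + k i))) / ν i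
      ≤ A / ν i * ((k i + n i : ℕ) : ℝ) := by
    rw [← add_div, div_mul_eq_mul_div]
    gcongr
    exact htot.trans (by gcongr)
  have h9 := mul_le_mul_of_nonneg_left h8 hC0
  have h10 : C * (n i * D) ≤ C * (((k i + n i : ℕ) : ℝ) * D) := by gcongr
  have h11 : (k i : ℝ) * ε + n i * ε = ((k i + n i : ℕ) : ℝ) * ε := by push_cast; ring
  linarith

end Averages

/-! ### The scaled parameters and floor multi-indices. -/

section ZeroDistribution

open Polynomial

theorem scaledParams_last {m : ℕ} (a : Fin (m + 1) → ℝ) (N : ℕ) :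
    scaledParams a N (Fin.last m) = N * a (Fin.last m) := by
  simp [scaledParams]

theorem scaledParams_of_ne {m : ℕ} (a : Fin (m + 1) → ℝ) (N : ℕ) {j : Fin (m + 1)}
    (hj : j ≠ Fin.last m) : scaledParams a N j = a j := by
  simp [scaledParams, hj]

theorem scaledParams_pos {m : ℕ} {a : Fin (m + 1) → ℝ} (ha : ∀ j, 0 < a j) {N : ℕ} (hN : 0 < N)
    (j : Fin (m + 1)) : 0 < scaledParams a N j := by
  by_cases hj : j = Fin.last m
  · rw [hj, scaledParams_last]
    exact mul_pos (by exact_mod_cast hN) (ha _)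
  · rw [scaledParams_of_ne a N hj]
    exact ha j

theorem scaledParams_injective {m : ℕ} {a : Fin (m + 1) → ℝ} {N : ℕ}
    (hdist : ∀ i j, i ≠ Fin.last m → j ≠ Fin.last m → i ≠ j → a i ≠ a j)
    (hN : ∀ j, j ≠ Fin.last m → a j ≠ (N : ℝ) * a (Fin.last m)) :
    Function.Injective (scaledParams a N) := by
  intro i j hij
  by_contra hne
  by_cases hi : i = Fin.last m
  · have hj : j ≠ Fin.last m := fun h => hne (hi.trans h.symm)
    rw [hi, scaledParams_last, scaledParams_of_ne a N hj] at hij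
    exact hN j hj hij.symm
  · rw [scaledParams_of_ne a N hi] at hij
    by_cases hj : j = Fin.last m
    · rw [hj, scaledParams_last] at hij
      exact hN i hi hij
    · rw [scaledParams_of_ne a N hj] at hij
      exact hdist i j hi hj hne hij

/-- The number of zeros that come from the parameters other than the last one. -/
noncomputable def headCount {m : ℕ} (q : Fin (m + 1) → ℝ) (n : ℕ) : ℕ :=
  ∑ j ∈ Finset.univ.erase (Fin.last m), floorIndex q n j

theorem headCount_add {m : ℕ} (q : Fin (m + 1) → ℝ) (n : ℕ) :
    headCount q n + floorIndex q n (Fin.last m) = ∑ j, floorIndex q n j :=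
  Finset.sum_erase_add _ _ (Finset.mem_univ _)

/-- The zeros of the multiple Charlier polynomial and of the Charlier polynomial that belongs to
the last parameter, compared. -/
theorem exists_zeros {m : ℕ} (q : Fin (m + 1) → ℝ) {a : Fin (m + 1) → ℝ} (ha : ∀ j, 0 < a j)
    (n : ℕ) {N : ℕ} (hN : 0 < N) : ∃ x y : ℕ → ℝ,
      SpacedRoots (umbral ((X - C (N * a (Fin.last m))) ^ floorIndex q n (Fin.last m)))
        (floorIndex q n (Fin.last m)) x ∧
      SpacedRoots (charlierProd (floorIndex q n) (scaledParams a N))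
        (headCount q n + floorIndex q n (Fin.last m)) y ∧
      (∀ j < headCount q n, (j : ℝ) ≤ y j) ∧
      (∀ j < floorIndex q n (Fin.last m), x j + headCount q n ≤ y (headCount q n + j)) ∧
      ∑ j ∈ Finset.range (headCount q n + floorIndex q n (Fin.last m)), y j
        ≤ ∑ j ∈ Finset.range (headCount q n), (j : ℝ)
          + ∑ j ∈ Finset.range (floorIndex q n (Fin.last m)), (x j + headCount q n)
          + (∑ j, a j) * headCount q n := by
  have hb : 0 < (N : ℝ) * a (Fin.last m) := mul_pos (by exact_mod_cast hN) (ha _)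
  obtain ⟨x, hx⟩ := exists_spacedRoots_umbral_pow hb (floorIndex q n (Fin.last m))
  obtain ⟨y, hy, h1, h2, h3⟩ := hx.exists_umbral_mul
    (paramMultiset (floorIndex q n) (scaledParams a N) (Finset.univ.erase (Fin.last m)))
    fun c hc => pos_of_mem_paramMultiset (scaledParams_pos ha hN) hc
  rw [card_paramMultiset] at hy h1 h2 h3
  rw [prod_paramMultiset, ← scaledParams_last, Finset.prod_erase_mul _ _ (Finset.mem_univ _)] at hy
  rw [sum_paramMultiset] at h3
  refine ⟨x, y, hx, hy, h1, h2, h3.trans_le (add_le_add_right ?_ _)⟩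
  rw [headCount]
  push_cast
  rw [Finset.mul_sum]
  refine Finset.sum_le_sum fun j hj => ?_
  rw [scaledParams_of_ne a N (Finset.ne_of_mem_erase hj), mul_comm]
  gcongr
  exact Finset.single_le_sum (f := a) (fun i _ => (ha i).le) (Finset.mem_univ j)

theorem tendsto_floorIndex_div {m : ℕ} {q : Fin (m + 1) → ℝ} {t : ℝ} {F : Filter (ℕ × ℕ)}
    (hF : Tendsto Prod.fst F atTop) (ht : Tendsto (fun p : ℕ × ℕ => (p.1 : ℝ) / (p.2 : ℝ)) F (𝓝 t))
    {j : Fin (m + 1)} (hq : 0 < q j) :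
    Tendsto (fun p : ℕ × ℕ => (floorIndex q p.1 j : ℝ) / (p.2 : ℝ)) F (𝓝 (q j * t)) := by
  have h1 := (tendsto_nat_floor_mul_div_atTop hq.le).comp
    ((tendsto_natCast_atTop_atTop (R := ℝ)).comp hF)
  refine (h1.mul ht).congr' ?_
  filter_upwards [hF.eventually_gt_atTop 0] with p hp
  have : (p.1 : ℝ) ≠ 0 := by positivity
  simp only [Function.comp_apply, floorIndex]
  field_simp

end ZeroDistribution

/-! ### The main theorem. -/

theorem theorem4 (m : ℕ) (q a : Fin (m + 1) → ℝ) (t : ℝ)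
    (hq : ∀ j, 0 < q j ∧ q j < 1) (hqsum : ∑ j, q j = 1)
    (ha : ∀ j, 0 < a j)
    (hdist : ∀ i j, i ≠ Fin.last m → j ≠ Fin.last m → i ≠ j → a i ≠ a j)
    (ht : 0 < t) :
    -- the polynomials and their zeros are well defined
    (∀ n N : ℕ, 0 < N → (∀ j, j ≠ Fin.last m → a j ≠ (N : ℝ) * a (Fin.last m)) →
      (∃! P : Polynomial ℝ, IsMultipleCharlier (floorIndex q n) (scaledParams a N) P) ∧
      (multipleCharlier (floorIndex q n) (scaledParams a N)).roots.card
        = ∑ j, floorIndex q n j ∧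
      (multipleCharlier (floorIndex q n) (scaledParams a N)).roots.Nodup ∧
      ∀ x ∈ (multipleCharlier (floorIndex q n) (scaledParams a N)).roots, 0 < x) ∧
    -- the limit of the zero distributions
    (∀ f : ℝ → ℝ, ContinuousOn f (Ici 0) → (∃ M : ℝ, ∀ x ∈ Ici (0 : ℝ), |f x| ≤ M) →
      Tendsto
        (fun p : ℕ × ℕ =>
          zeroAverage (multipleCharlier (floorIndex q p.1) (scaledParams a p.2))
            (∑ j, floorIndex q p.1 j) p.2 f)
        ((atTop ×ˢ atTop) ⊓ comap (fun p : ℕ × ℕ => (p.1 : ℝ) / (p.2 : ℝ)) (𝓝 t))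
        (𝓝 (1 / t * (∫ x in (0 : ℝ)..((1 - q (Fin.last m)) * t), f x) +
          q (Fin.last m) *
            ∫ x in (alphaEnd (a (Fin.last m)) (q (Fin.last m)) t)..(betaEnd (a (Fin.last m))
              (q (Fin.last m)) t), zeroDensity (a (Fin.last m)) (q (Fin.last m)) t x * f x))) ∧
    -- the position of `[α_t, β_t]`, and the two cases
    (1 - q (Fin.last m)) * t ≤ alphaEnd (a (Fin.last m)) (q (Fin.last m)) t ∧
    alphaEnd (a (Fin.last m)) (q (Fin.last m)) t < betaEnd (a (Fin.last m)) (q (Fin.last m)) t ∧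
    ((1 - q (Fin.last m)) * t < alphaEnd (a (Fin.last m)) (q (Fin.last m)) t ↔
      q (Fin.last m) * t < a (Fin.last m)) ∧
    -- `v` is a probability density on `[α_t, β_t]`, positive inside
    (∀ y ∈ Icc (alphaEnd (a (Fin.last m)) (q (Fin.last m)) t)
        (betaEnd (a (Fin.last m)) (q (Fin.last m)) t),
      0 ≤ zeroDensity (a (Fin.last m)) (q (Fin.last m)) t y) ∧
    (∀ y ∈ Ioo (alphaEnd (a (Fin.last m)) (q (Fin.last m)) t)
        (betaEnd (a (Fin.last m)) (q (Fin.last m)) t),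
      0 < zeroDensity (a (Fin.last m)) (q (Fin.last m)) t y) ∧
    IntervalIntegrable (zeroDensity (a (Fin.last m)) (q (Fin.last m)) t) volume
      (alphaEnd (a (Fin.last m)) (q (Fin.last m)) t)
      (betaEnd (a (Fin.last m)) (q (Fin.last m)) t) ∧
    ∫ y in (alphaEnd (a (Fin.last m)) (q (Fin.last m)) t)..(betaEnd (a (Fin.last m))
      (q (Fin.last m)) t), zeroDensity (a (Fin.last m)) (q (Fin.last m)) t y = 1 := by
  have hlast : 0 < q (Fin.last m) * t := mul_pos (hq _).1 ht
  have haL := ha (Fin.last m)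
  have hmult : ∀ n N : ℕ, 0 < N → (∀ j, j ≠ Fin.last m → a j ≠ (N : ℝ) * a (Fin.last m)) →
      multipleCharlier (floorIndex q n) (scaledParams a N)
        = charlierProd (floorIndex q n) (scaledParams a N) := fun n N hN hne =>
    multipleCharlier_eq _ (scaledParams_pos ha hN) (scaledParams_injective hdist hne)
  refine ⟨fun n N hN hne => ?_, fun f hf hfM => ?_, le_alphaEnd haL.le hlast.le,
    alphaEnd_lt_betaEnd haL hlast, lt_alphaEnd_iff haL hlast,
    fun y hy => zeroDensity_nonneg haL hlast hy, fun y hy => zeroDensity_pos haL hlast hy,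
    intervalIntegrable_zeroDensity haL hlast, integral_zeroDensity haL hlast⟩
  · have hpos := scaledParams_pos ha hN
    have hinj := scaledParams_injective hdist hne
    obtain ⟨y, hy⟩ := exists_spacedRoots_charlierProd (floorIndex q n) hpos
    rw [hmult n N hN hne]
    refine ⟨⟨_, isMultipleCharlier_charlierProd _ hpos,
      fun P hP => hP.eq_charlierProd hpos hinj⟩, ?_, hy.nodup_roots, fun x hx => ?_⟩
    · rw [hy.roots, Multiset.card_map, Multiset.card_range]
    · rw [hy.roots, Multiset.mem_map] at hx
      obtain ⟨i, hi, rfl⟩ := hx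
      exact hy.pos i (Multiset.mem_range.1 hi)
  · obtain ⟨M, hM⟩ := hfM
    set F : Filter (ℕ × ℕ) :=
      (atTop ×ˢ atTop) ⊓ comap (fun p : ℕ × ℕ => (p.1 : ℝ) / (p.2 : ℝ)) (𝓝 t)
    have hF1 : Tendsto Prod.fst F atTop := tendsto_fst.mono_left inf_le_left
    have hF2 : Tendsto Prod.snd F atTop := tendsto_snd.mono_left inf_le_left
    have hFt : Tendsto (fun p : ℕ × ℕ => (p.1 : ℝ) / (p.2 : ℝ)) F (𝓝 t) :=
      tendsto_comap.mono_left inf_le_right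
    have hν : Tendsto (fun p : ℕ × ℕ => (p.2 : ℝ)) F atTop :=
      tendsto_natCast_atTop_atTop.comp hF2
    have hk : Tendsto (fun p : ℕ × ℕ => (headCount q p.1 : ℝ) / (p.2 : ℝ)) F
        (𝓝 ((1 - q (Fin.last m)) * t)) := by
      have h := tendsto_finsetSum (Finset.univ.erase (Fin.last m)) fun j _ =>
        tendsto_floorIndex_div hF1 hFt (hq j).1
      have e : ∑ j ∈ Finset.univ.erase (Fin.last m), q j * t = (1 - q (Fin.last m)) * t := by
        rw [← Finset.sum_mul, ← hqsum, ← Finset.sum_erase_add _ _ (Finset.mem_univ (Fin.last m)),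
          add_sub_cancel_right]
      rw [e] at h
      refine h.congr fun p => ?_
      rw [headCount, Nat.cast_sum, Finset.sum_div]
    have hzeros : ∀ p : ℕ × ℕ, ∃ x y : ℕ → ℝ, 0 < p.2 → _ := fun p => by
      by_cases hN : 0 < p.2
      · obtain ⟨x, y, h⟩ := exists_zeros q ha p.1 hN
        exact ⟨x, y, fun _ => h⟩
      · exact ⟨0, 0, fun h => absurd h hN⟩
    choose x y hxy using hzeros
    have hN0 : ∀ᶠ p in F, 0 < p.2 := hF2.eventually_gt_atTop 0
    -- Eventually `N a_r` exceeds every `a j`, so the closed form applies.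
    have hne : ∀ᶠ p in F, ∀ j, j ≠ Fin.last m → a j ≠ (p.2 : ℝ) * a (Fin.last m) := by
      rw [eventually_all]
      intro j
      filter_upwards [(hν.atTop_mul_const haL).eventually_gt_atTop (a j)] with p hp _
      exact hp.ne
    -- A bounded continuous extension of `f` to the line; the zeros and the limit measure only see
    -- `[0, ∞)`.
    set g : ℝ → ℝ := fun x => f (max x 0) with hg
    have hgc : Continuous g := hf.comp_continuous (by fun_prop) fun x => le_max_right x 0
    have hgf : ∀ x, 0 ≤ x → g x = f x := fun x hx => by simp only [hg, max_eq_left hx]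
    have hmain := tendsto_average_of_dominates (F := F) haL (hq _).1 (hq _).2 ht hν
      (tendsto_floorIndex_div hF1 hFt (hq (Fin.last m)).1) hk (x := x) (y := y)
      (hN0.mono fun p hp => (hxy p hp).1) (hN0.mono fun p hp => (hxy p hp).2.2.1)
      (hN0.mono fun p hp => (hxy p hp).2.2.2.1) (A := ∑ j, a j)
      (Finset.sum_nonneg fun j _ => (ha j).le) (hN0.mono fun p hp => (hxy p hp).2.2.2.2)
      hgc (M := M) fun x => hM _ (le_max_right x 0)
    have hτ : 0 ≤ (1 - q (Fin.last m)) * t := mul_nonneg (sub_nonneg.2 (hq _).2.le) ht.le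
    have e1 : ∫ x in (0 : ℝ)..((1 - q (Fin.last m)) * t), g x
        = ∫ x in (0 : ℝ)..((1 - q (Fin.last m)) * t), f x := by
      refine intervalIntegral.integral_congr fun x hx => hgf x ?_
      rw [uIcc_of_le hτ] at hx
      exact hx.1
    have e2 : ∫ x in (alphaEnd (a (Fin.last m)) (q (Fin.last m)) t)..(betaEnd (a (Fin.last m))
          (q (Fin.last m)) t), zeroDensity (a (Fin.last m)) (q (Fin.last m)) t x * g x
        = ∫ x in (alphaEnd (a (Fin.last m)) (q (Fin.last m)) t)..(betaEnd (a (Fin.last m))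
          (q (Fin.last m)) t), zeroDensity (a (Fin.last m)) (q (Fin.last m)) t x * f x := by
      refine intervalIntegral.integral_congr fun x hx => ?_
      rw [uIcc_of_le (alphaEnd_lt_betaEnd haL hlast).le] at hx
      rw [hgf x (hτ.trans ((le_alphaEnd haL.le hlast.le).trans hx.1))]
    rw [e1, e2] at hmain
    refine hmain.congr' ?_
    filter_upwards [hN0, hne] with p hp hpne
    have hy := (hxy p hp).2.1
    rw [zeroAverage, hmult p.1 p.2 hp hpne, hy.roots, ← headCount_add, Multiset.map_map]
    congr 1
    refine Finset.sum_congr rfl fun j hj => hgf _ ?_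
    exact div_nonneg (hy.pos j (Finset.mem_range.1 hj)).le (Nat.cast_nonneg _)
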